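/- Let $n\ge 0$ and $q\ge 1$ be integers and consider $n$ qudits of local dimension $q$, with single-qudit basis $\{|j\rangle\}_{j\in\mathbb Z/q}$, $\omega=e^{2\pi i/q}$, $Z|j\rangle=\omega^j|j\rangle$, $X|j\rangle=|j+1 \bmod q\rangle$. The Pauli group is generated by $\omega I$ and the tensor products of single-qudit Pauli operators $Z^aX^b$. A pure stabilizer state is a unit vector that is, up to scalars, the unique common eigenvector, for some assignment of eigenvalues, of a group of commuting Pauli operators. Let $\mathcal D$ be the set of density matrices and $\mathcal S\subseteq\mathcal D$ the convex hull of the projectors onto pure stabilizer states. For $\rho\in\mathcal D$ define (with values in $[-\infty,+\infty]$, the infimum of the empty set being $+\infty$, and the same base for all logarithms) - $\operatorname{LF}(\rho)=-\log\sup_{\sigma\in\mathcal S}\|\sqrt\rho\sqrt\sigma\|_1^2$; - $S(\rho\|\mathcal S)=\inf_{\sigma\in\mathcal S}S(\rho\|\sigma)$, where $S(\rho\|\sigma)=\operatorname{Tr}(\rho\log\rho)-\operatorname{Tr}(\rho\log\sigma)$ if $\operatorname{supp}\rho\subseteq\operatorname{supp}\sigma$, and $+\infty$ otherwise; - $S_{\max}(\rho\|\mathcal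 S)=\inf_{\sigma\in\mathcal S}S_{\max}(\rho\|\sigma)$, where $S_{\max}(\rho\|\sigma)=\log\inf\{\lambda\ge0:\rho\preceq\lambda\sigma\}$; - $\operatorname{LGR}(\rho)=\log(1+2\operatorname{GR}(\rho))$, where $\operatorname{GR}(\rho)=\inf\{s\ge0:\exists\,\sigma'\in\mathcal S,\ \sigma\in\mathcal D,\ \rho=(1+s)\sigma'-s\sigma\}$; - $\operatorname{LR}(\rho)=\log(1+2\operatorname{R}(\rho))$, where $\operatorname{R}(\rho)=\inf\{s\ge0:\exists\,\sigma,\sigma'\in\mathcal S,\ \rho=(1+s)\sigma'-s\sigma\}$. Then for every density matrix $\rho$ of the $n$ qudits, $$\operatorname{LF}(\rho)\le S(\rho\|\mathcal S)\le S_{\max}(\rho\|\mathcal S)\le\operatorname{LGR}(\rho)\le\operatorname{LR}(\rho),$$ and each of these five quantities is at most $(n+2^{-n-1})\log q$. -/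

import Mathlib

open scoped Matrix NNReal ENNReal ComplexOrder

noncomputable section

namespace QuditMagic

/-- Labels `|j₁, …, jₙ⟩` of the computational basis of `n` qudits of local dimension `q`. -/
abbrev Idx (n q : ℕ) : Type := Fin n → ZMod q

/-- Operators on the Hilbert space of `n` qudits of local dimension `q`. -/
abbrev Op (n q : ℕ) : Type := Matrix (Idx n q) (Idx n q) ℂ

/-- The root of unity `ω = exp (2πi/q)`. -/
def omega (q : ℕ) : ℂ := Complex.exp (2 * Real.pi * Complex.I / q)

/-- The clock operator `Z |j⟩ = ω ^ j |j⟩`. -/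
def clockZ (q : ℕ) : Matrix (ZMod q) (ZMod q) ℂ :=
  Matrix.diagonal fun j => omega q ^ j.val

/-- The shift operator `X |j⟩ = |j + 1 mod q⟩`. -/
def shiftX (q : ℕ) : Matrix (ZMod q) (ZMod q) ℂ :=
  Matrix.of fun j k => if j = k + 1 then 1 else 0

/-- The tensor product `A₁ ⊗ ⋯ ⊗ Aₙ` of single-qudit operators. -/
def tensorOp {n q : ℕ} (A : Fin n → Matrix (ZMod q) (ZMod q) ℂ) : Op n q :=
  Matrix.of fun x y => ∏ i, A i (x i) (y i)

/-- The `n`-qudit Pauli group: generated, inside the group of invertible operators, by `ω I` and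
the tensor products of the single-qudit Pauli operators `Z ^ a X ^ b`. -/
def pauliGroup (n q : ℕ) [NeZero q] : Subgroup (Op n q)ˣ :=
  Subgroup.closure
    {u | (u : Op n q) = omega q • (1 : Op n q) ∨
      ∃ a b : Fin n → ℕ, (u : Op n q) = tensorOp fun i => clockZ q ^ a i * shiftX q ^ b i}

/-- `ψ` is a pure stabilizer state: a unit vector which, for some group `G` of commuting Pauli
operators and some assignment `χ` of eigenvalues, is the unique common eigenvector of `G` with
these eigenvalues, up to scalars. -/
def IsPureStabilizer {n q : ℕ} [NeZero q] (ψ : Idx n q → ℂ) : Prop :=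
  star ψ ⬝ᵥ ψ = 1 ∧
    ∃ G : Subgroup (Op n q)ˣ, G ≤ pauliGroup n q ∧
      (∀ P ∈ G, ∀ Q ∈ G, P * Q = Q * P) ∧
      ∃ χ : (Op n q)ˣ → ℂ, ∀ φ : Idx n q → ℂ,
        (∀ P ∈ G, (P : Op n q) *ᵥ φ = χ P • φ) ↔ ∃ c : ℂ, φ = c • ψ

/-- Density matrices (the set `𝒟`). -/
def IsState {n q : ℕ} [NeZero q] (ρ : Op n q) : Prop :=
  ρ.PosSemidef ∧ ρ.trace = 1

/-- The set `𝒮` of states without magic: convex combinations of the projectors `|ψ⟩⟨ψ|` onto pure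
stabilizer states. -/
def stabMixtures (n q : ℕ) [NeZero q] : Set (Op n q) :=
  convexHull ℝ {σ | ∃ ψ : Idx n q → ℂ, IsPureStabilizer ψ ∧ σ = Matrix.vecMulVec ψ (star ψ)}

variable {n q : ℕ} [NeZero q]

/-- The trace norm `‖A‖₁ = Tr √(A† A)`. -/
def traceNorm (A : Op n q) : ℝ := (cfc Real.sqrt (Aᴴ * A)).trace.re

/-- The fidelity `ℱ(ρ, σ) = ‖√ρ √σ‖₁ ^ 2`. -/
def fidelity (ρ σ : Op n q) : ℝ := traceNorm (cfc Real.sqrt ρ * cfc Real.sqrt σ) ^ 2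

/-- The stabilizer fidelity. -/
def stabFidelity (ρ : Op n q) : ℝ≥0∞ := ⨆ σ ∈ stabMixtures n q, ENNReal.ofReal (fidelity ρ σ)

/-- The log-stabilizer fidelity `LF`. -/
def logStabFidelity (ρ : Op n q) : EReal := -ENNReal.log (stabFidelity ρ)

open Classical in
/-- The relative entropy `S(ρ‖σ) = Tr (ρ log ρ) - Tr (ρ log σ)`, with value `+∞` unless the support
of `ρ` is contained in that of `σ`. (The functional calculus uses `Real.log 0 = 0`, which
implements `0 log 0 = 0`, and restricts `log σ` to the support of `σ`.) -/
def relEntropy (ρ σ : Op n q) : EReal :=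
  if ∀ v : Idx n q → ℂ, σ *ᵥ v = 0 → ρ *ᵥ v = 0 then
    (((ρ * cfc Real.log ρ).trace - (ρ * cfc Real.log σ).trace).re : EReal)
  else ⊤

/-- The relative entropy of magic `S(ρ‖𝒮)`. -/
def relEntropyMagic (ρ : Op n q) : EReal := ⨅ σ ∈ stabMixtures n q, relEntropy ρ σ

/-- The max-relative entropy `S_max(ρ‖σ) = log min {l ≥ 0 : ρ ≼ l σ}`, with value `+∞` if there is
no such `l`. -/
def maxRelEntropy (ρ σ : Op n q) : EReal :=
  ENNReal.log (⨅ (l : ℝ≥0) (_ : ((l : ℝ) • σ - ρ).PosSemidef), (l : ℝ≥0∞))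

/-- The max-relative entropy of magic `S_max(ρ‖𝒮)`. -/
def maxRelEntropyMagic (ρ : Op n q) : EReal := ⨅ σ ∈ stabMixtures n q, maxRelEntropy ρ σ

/-- The robustness of magic `R`. -/
def robustness (ρ : Op n q) : ℝ≥0∞ :=
  ⨅ (s : ℝ≥0) (_ : ∃ σ' ∈ stabMixtures n q, ∃ σ ∈ stabMixtures n q,
    ρ = (1 + (s : ℝ)) • σ' - (s : ℝ) • σ), (s : ℝ≥0∞)

/-- The generalized robustness of magic `GR`. -/
def genRobustness (ρ : Op n q) : ℝ≥0∞ :=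
  ⨅ (s : ℝ≥0) (_ : ∃ σ' ∈ stabMixtures n q, ∃ σ : Op n q, IsState σ ∧
    ρ = (1 + (s : ℝ)) • σ' - (s : ℝ) • σ), (s : ℝ≥0∞)

/-- The log-robustness of magic `LR`. -/
def logRobustness (ρ : Op n q) : EReal := ENNReal.log (1 + 2 * robustness ρ)

/-- The log-generalized robustness of magic `LGR`. -/
def logGenRobustness (ρ : Op n q) : EReal := ENNReal.log (1 + 2 * genRobustness ρ)

end QuditMagic

end

/-!
The chain of inequalities compares the five quantities for a fixed `σ`, and uses that every
`σ ∈ 𝒮` is a state. Let `l i`, `m j` be the eigenvalues of `ρ`, `σ` and `w i j` the squared overlaps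
of their eigenvectors. Then `S(ρ‖σ)` is the classical relative entropy of `l i * w i j` and
`m j * w i j`, and `Tr (√ρ √σ)` is the classical overlap of these distributions. Since
`‖√ρ √σ‖₁ ≥ Tr (√ρ √σ)`, Jensen's inequality gives `-log ℱ(ρ, σ) ≤ S(ρ‖σ)`
(`neg_log_fidelity_le_relEntropy`). If `ρ ≼ c σ`, testing with the vector `σ⁻¹ e` for an eigenvector
`e` of `ρ` gives `l i * ∑ j, w i j / m j ≤ c`, and Jensen's inequality in each row gives
`S(ρ‖σ) ≤ log c` (`relEntropy_le_log`), without operator monotonicity of the logarithm. The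
comparisons with the robustnesses are immediate.

It remains to bound `LR`. Put `d = q ^ n`. The `d ^ 2` Pauli operators `Z ^ a X ^ b` are an
orthogonal basis of the operators, labelled by the points `v = (a, b)` of the phase space `(ℤ/q) ^ (2 n)`; they
commute where the symplectic form vanishes. For a state the coefficients `c v` satisfy `c 0 = 1` and
`∑ v, |c v| ^ 2 ≤ d`. The `d` Pauli operators in a symplectic image of the Lagrangian submodule
`{(a, 0)}` commute; their joint eigenvectors form an orthonormal basis of pure stabilizer states
(`isPureStabilizer_col`), in which all their linear combinations are diagonal. If `N v` of the
`G` elements of the symplectic group give images containing `v`, distribute the term of `v` in the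
Pauli expansion of `ρ` equally over these `N v` images. The result is a decomposition of `ρ` into
stabilizer projectors, and by the Cauchy–Schwarz inequality the square of the `ℓ¹` norm of its
coefficients is at most `∑ v, |c v| ^ 2 * G / N v` (`logRobustness_le`).

For `N v`, note that the symplectic group is transitive on primitive vectors
(`exists_symp_apply_eq`: transvections, and the Chinese remainder theorem), that every `v ≠ 0` is a
multiple of a primitive vector, and that the number of primitive vectors is given by Jordan's
totient. Counting incidences, `G / N v ≤ d * ∏ p ∣ q, (1 + p ^ (-n))` for `v ≠ 0`
(`card_symp_le_incidence_mul`). So the squared norm is at most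
`1 + (d - 1) * d * ∏ p ∣ q, (1 + p ^ (-n))`, and this is at most `(q ^ (n + 2 ^ (-n - 1))) ^ 2`
(`one_add_mul_prod_le`).
-/

namespace QuditMagic

/-! ### Spectral data of a pair of Hermitian matrices -/

section Spectral

variable {ι : Type*} [Fintype ι] [DecidableEq ι]

/-- The functional calculus of a Hermitian matrix in one fixed eigenbasis. -/
lemma exists_spectral_data {A : Matrix ι ι ℂ} (hA : A.IsHermitian) :
    ∃ (U : Matrix ι ι ℂ) (l : ι → ℝ), Uᴴ * U = 1 ∧ U * Uᴴ = 1 ∧ l = hA.eigenvalues ∧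
      A = U * Matrix.diagonal (fun i => (l i : ℂ)) * Uᴴ ∧
      ∀ f : ℝ → ℝ, cfc f A = U * Matrix.diagonal (fun i => (f (l i) : ℂ)) * Uᴴ := by
  refine ⟨hA.eigenvectorUnitary, hA.eigenvalues, ?_, ?_, rfl, ?_, fun f => ?_⟩
  · rw [← Matrix.star_eq_conjTranspose]; exact Unitary.coe_star_mul_self _
  · rw [← Matrix.star_eq_conjTranspose]; exact Unitary.coe_mul_star_self _
  · conv_lhs => rw [hA.spectral_theorem]
    rfl
  · rw [hA.cfc_eq, Matrix.IsHermitian.cfc]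
    rfl

lemma trace_conj_diagonal {U : Matrix ι ι ℂ} (hU : Uᴴ * U = 1) (a : ι → ℂ) :
    (U * Matrix.diagonal a * Uᴴ).trace = ∑ i, a i := by
  rw [Matrix.trace_mul_comm, ← mul_assoc, hU, one_mul, Matrix.trace_diagonal]

lemma trace_conj_diagonal_mul_conj_diagonal (U V : Matrix ι ι ℂ) (a b : ι → ℂ) :
    ((U * Matrix.diagonal a * Uᴴ) * (V * Matrix.diagonal b * Vᴴ)).trace =
      ∑ i, ∑ j, a i * b j * (Complex.normSq ((Uᴴ * V) i j) : ℂ) := by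
  have h : ((U * Matrix.diagonal a * Uᴴ) * (V * Matrix.diagonal b * Vᴴ)).trace =
      ((Matrix.diagonal a * (Uᴴ * V)) * (Matrix.diagonal b * (Uᴴ * V)ᴴ)).trace := by
    rw [Matrix.conjTranspose_mul, Matrix.conjTranspose_conjTranspose, mul_assoc U, mul_assoc U,
      Matrix.trace_mul_comm]
    simp only [mul_assoc]
  rw [h]
  simp only [Matrix.trace, Matrix.diag, Matrix.mul_apply (M := Matrix.diagonal a * (Uᴴ * V)),
    Matrix.diagonal_mul, Matrix.conjTranspose_apply (Uᴴ * V)]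
  refine Finset.sum_congr rfl fun i _ => Finset.sum_congr rfl fun j _ => ?_
  rw [Complex.normSq_eq_conj_mul_self]
  simp only [Complex.star_def]
  ring

lemma sum_normSq_row {W : Matrix ι ι ℂ} (hW : W * Wᴴ = 1) (i : ι) :
    ∑ j, Complex.normSq (W i j) = 1 := by
  have h := congrFun (congrFun hW i) i
  rw [Matrix.mul_apply, Matrix.one_apply_eq] at h
  have h2 : ((∑ j, Complex.normSq (W i j) : ℝ) : ℂ) = 1 := by
    rw [← h]
    push_cast
    refine Finset.sum_congr rfl fun j _ => ?_
    rw [Matrix.conjTranspose_apply, Complex.star_def, Complex.mul_conj]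
  exact_mod_cast h2

lemma star_dotProduct_diagonal_mulVec (d : ι → ℝ) (x : ι → ℂ) :
    star x ⬝ᵥ (Matrix.diagonal (fun i => (d i : ℂ)) *ᵥ x) =
      ((∑ i, d i * Complex.normSq (x i) : ℝ) : ℂ) := by
  simp only [dotProduct, Matrix.mulVec_diagonal, Pi.star_apply, Complex.star_def]
  push_cast
  refine Finset.sum_congr rfl fun i _ => ?_
  rw [Complex.normSq_eq_conj_mul_self]
  ring

/-- The trace norm dominates the trace: in an eigenbasis `e i` of `Aᴴ * A`, the modulus
`|⟨e i, A e i⟩|` is at most `‖A e i‖`, which is the `i`-th singular value. -/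
lemma re_trace_le_trace_sqrt (A : Matrix ι ι ℂ) :
    A.trace.re ≤ (cfc Real.sqrt (Aᴴ * A)).trace.re := by
  have hH : (Aᴴ * A).IsHermitian := Matrix.isHermitian_conjTranspose_mul_self A
  obtain ⟨U, l, hU, hU', -, hA, hcfc⟩ := exists_spectral_data hH
  rw [hcfc, trace_conj_diagonal hU]
  have htr : A.trace = (Uᴴ * A * U).trace := by
    rw [Matrix.trace_mul_comm, ← mul_assoc, hU', one_mul]
  rw [htr, Matrix.trace, Complex.re_sum, Complex.re_sum]
  set B := Uᴴ * A * U with hB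
  have hBB : Bᴴ * B = Matrix.diagonal (fun i => (l i : ℂ)) := by
    have : Bᴴ * B = Uᴴ * (Aᴴ * (U * Uᴴ) * A) * U := by
      simp only [hB, Matrix.conjTranspose_mul, Matrix.conjTranspose_conjTranspose, mul_assoc]
    rw [this, hU', mul_one, hA]
    calc Uᴴ * (U * Matrix.diagonal (fun i => (l i : ℂ)) * Uᴴ) * U
        = (Uᴴ * U) * Matrix.diagonal (fun i => (l i : ℂ)) * (Uᴴ * U) := by simp only [mul_assoc]
      _ = _ := by rw [hU, one_mul, mul_one]
  refine Finset.sum_le_sum fun i _ => ?_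
  have hi : ((∑ j, Complex.normSq (B j i) : ℝ) : ℂ) = (l i : ℂ) := by
    have h := congrFun (congrFun hBB i) i
    rw [Matrix.mul_apply, Matrix.diagonal_apply_eq] at h
    rw [← h]
    push_cast
    refine Finset.sum_congr rfl fun j _ => ?_
    rw [Matrix.conjTranspose_apply, Complex.star_def, Complex.normSq_eq_conj_mul_self]
  have hi' : ∑ j, Complex.normSq (B j i) = l i := by exact_mod_cast hi
  have hle : Complex.normSq (B i i) ≤ l i := by
    rw [← hi']
    exact Finset.single_le_sum (f := fun j => Complex.normSq (B j i))
      (fun j _ => Complex.normSq_nonneg _) (Finset.mem_univ i)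
  calc (B.diag i).re ≤ ‖B i i‖ := Complex.re_le_norm _
    _ = Real.sqrt (Complex.normSq (B i i)) := rfl
    _ ≤ Real.sqrt (l i) := Real.sqrt_le_sqrt hle
    _ = _ := by rw [Complex.ofReal_re]

end Spectral

/-! ### Two inequalities for the classical relative entropy -/

section Classical

variable {ι κ : Type*} [Fintype ι] [Fintype κ] {w : ι → κ → ℝ} {l : ι → ℝ} {m : κ → ℝ}

lemma overlap_pos (hw : ∀ i j, 0 ≤ w i j) (hl : ∀ i, 0 ≤ l i) (hm : ∀ j, 0 ≤ m j)
    (hp : ∑ i, ∑ j, l i * w i j = 1) (hs : ∀ i j, m j = 0 → l i * w i j = 0) :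
    0 < ∑ i, ∑ j, √(l i) * √(m j) * w i j := by
  have hnn : ∀ i j, 0 ≤ √(l i) * √(m j) * w i j := fun i j =>
    mul_nonneg (mul_nonneg (Real.sqrt_nonneg _) (Real.sqrt_nonneg _)) (hw i j)
  by_contra hcon
  have h0 : ∑ i, ∑ j, √(l i) * √(m j) * w i j = 0 :=
    le_antisymm (not_lt.mp hcon) (Finset.sum_nonneg fun i _ => Finset.sum_nonneg fun j _ => hnn i j)
  rw [Finset.sum_eq_zero_iff_of_nonneg
    (fun i _ => Finset.sum_nonneg fun j _ => hnn i j)] at h0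
  have : ∑ i, ∑ j, l i * w i j = 0 := by
    refine Finset.sum_eq_zero fun i _ => Finset.sum_eq_zero fun j _ => ?_
    have hij := (Finset.sum_eq_zero_iff_of_nonneg (fun j _ => hnn i j)).mp
      (h0 i (Finset.mem_univ i)) j (Finset.mem_univ j)
    rcases mul_eq_zero.mp hij with h | h
    · rcases mul_eq_zero.mp h with h | h
      · rw [(Real.sqrt_eq_zero (hl i)).mp h, zero_mul]
      · exact hs i j ((Real.sqrt_eq_zero (hm j)).mp h)
    · rw [h, mul_zero]
  linarith

/-- Jensen's inequality for the logarithm, in the form `-2 log ∑ √(p q) ≤ ∑ p log (p / q)`, for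
the distributions `p i j = l i * w i j` and `q i j = m j * w i j`. -/
lemma neg_two_mul_log_overlap_le (hw : ∀ i j, 0 ≤ w i j) (hl : ∀ i, 0 ≤ l i) (hm : ∀ j, 0 ≤ m j)
    (hp : ∑ i, ∑ j, l i * w i j = 1) (hs : ∀ i j, m j = 0 → l i * w i j = 0) :
    -(2 * Real.log (∑ i, ∑ j, √(l i) * √(m j) * w i j)) ≤
      ∑ i, ∑ j, l i * w i j * (Real.log (l i) - Real.log (m j)) := by
  have hK := overlap_pos hw hl hm hp hs
  set K := ∑ i, ∑ j, √(l i) * √(m j) * w i j with hKdef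
  -- The tangent line bound `log t ≤ t - 1` at `t = √(m / l) / K`, summed against `p`.
  have key : ∀ i j, l i * w i j * (Real.log (m j) / 2 - Real.log (l i) / 2 - Real.log K) ≤
      √(l i) * √(m j) * w i j / K - l i * w i j := by
    intro i j
    rcases eq_or_ne (l i * w i j) 0 with h | h
    · rw [h, zero_mul, sub_zero]
      exact div_nonneg (mul_nonneg (mul_nonneg (Real.sqrt_nonneg _) (Real.sqrt_nonneg _))
        (hw i j)) hK.le
    have hli : 0 < l i := lt_of_le_of_ne (hl i) fun h' => h (by rw [← h', zero_mul])
    have hmj : 0 < m j := lt_of_le_of_ne (hm j) fun h' => h (hs i j h'.symm)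
    have hsl := Real.sqrt_pos.mpr hli
    have hsm := Real.sqrt_pos.mpr hmj
    have hlog := Real.log_le_sub_one_of_pos (div_pos (div_pos hsm hsl) hK)
    rw [Real.log_div (div_pos hsm hsl).ne' hK.ne', Real.log_div hsm.ne' hsl.ne',
      Real.log_sqrt hmj.le, Real.log_sqrt hli.le] at hlog
    refine (mul_le_mul_of_nonneg_left hlog (mul_nonneg hli.le (hw i j))).trans_eq ?_
    have hsq : √(l i) * √(l i) = l i := Real.mul_self_sqrt hli.le
    field_simp
    linear_combination -(w i j * √(m j)) * hsq
  have hsum := Finset.sum_le_sum fun i (_ : i ∈ Finset.univ) =>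
    Finset.sum_le_sum fun j (_ : j ∈ Finset.univ) => key i j
  simp only [Finset.sum_sub_distrib, ← Finset.sum_div] at hsum
  rw [← hKdef, hp, div_self hK.ne', sub_self] at hsum
  have e : ∑ i, ∑ j, l i * w i j * (Real.log (m j) / 2 - Real.log (l i) / 2 - Real.log K) =
      -(∑ i, ∑ j, l i * w i j * (Real.log (l i) - Real.log (m j))) / 2 - Real.log K := by
    have e1 : ∀ i j, l i * w i j * (Real.log (m j) / 2 - Real.log (l i) / 2 - Real.log K) =
        -(1 / 2) * (l i * w i j * (Real.log (l i) - Real.log (m j))) -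
          l i * w i j * Real.log K := fun i j => by ring
    simp only [e1, Finset.sum_sub_distrib, ← Finset.sum_mul, hp]
    simp only [← Finset.mul_sum]
    ring
  rw [e] at hsum
  linarith

/-- Jensen's inequality for the logarithm in each row: `∑ j, w i j log (l i / m j)` is at most
the logarithm of `l i * ∑ j, w i j / m j`. -/
lemma sum_log_sub_log_le (hw : ∀ i j, 0 ≤ w i j) (hl : ∀ i, 0 ≤ l i) (hm : ∀ j, 0 ≤ m j)
    (hp : ∑ i, ∑ j, l i * w i j = 1) (hs : ∀ i j, m j = 0 → l i * w i j = 0)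
    (hrow : ∀ i, ∑ j, w i j = 1) {c : ℝ} (hc : 0 < c)
    (hle : ∀ i, l i * ∑ j, w i j / m j ≤ c) :
    ∑ i, ∑ j, l i * w i j * (Real.log (l i) - Real.log (m j)) ≤ Real.log c := by
  have key : ∀ i j, l i * w i j * (Real.log (l i) - Real.log (m j) - Real.log c) ≤
      l i * (l i * (w i j / m j)) / c - l i * w i j := by
    intro i j
    rcases eq_or_ne (l i * w i j) 0 with h | h
    · rw [h, zero_mul, sub_zero]
      exact div_nonneg (mul_nonneg (hl i) (mul_nonneg (hl i) (div_nonneg (hw i j) (hm j)))) hc.le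
    have hli : 0 < l i := lt_of_le_of_ne (hl i) fun h' => h (by rw [← h', zero_mul])
    have hmj : 0 < m j := lt_of_le_of_ne (hm j) fun h' => h (hs i j h'.symm)
    have hlog := Real.log_le_sub_one_of_pos (div_pos (div_pos hli hmj) hc)
    rw [Real.log_div (div_pos hli hmj).ne' hc.ne', Real.log_div hli.ne' hmj.ne'] at hlog
    refine (mul_le_mul_of_nonneg_left hlog (mul_nonneg hli.le (hw i j))).trans_eq ?_
    field_simp
  have hsum := Finset.sum_le_sum fun i (_ : i ∈ Finset.univ) =>
    Finset.sum_le_sum fun j (_ : j ∈ Finset.univ) => key i j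
  have hl1 : ∑ i, l i = 1 := by
    rw [← hp]
    exact Finset.sum_congr rfl fun i _ => by rw [← Finset.mul_sum, hrow, mul_one]
  have hR : ∑ i, ∑ j, (l i * (l i * (w i j / m j)) / c - l i * w i j) ≤ 0 := by
    simp only [Finset.sum_sub_distrib, hp, ← Finset.sum_div]
    simp only [← Finset.mul_sum]
    rw [sub_nonpos, div_le_one hc]
    calc ∑ i, l i * (l i * ∑ j, w i j / m j) ≤ ∑ i, l i * c :=
          Finset.sum_le_sum fun i _ => mul_le_mul_of_nonneg_left (hle i) (hl i)
      _ = c := by rw [← Finset.sum_mul, hl1, one_mul]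
  simp only [mul_sub _ _ (Real.log c), Finset.sum_sub_distrib, ← Finset.sum_mul, hp, one_mul]
    at hsum hR
  linarith

end Classical

/-! ### Fidelity, relative entropy and max-relative entropy -/

section Entropies

variable {n q : ℕ} [NeZero q]

/-- Two states in their eigenbases: eigenvalues `l`, `m`, and the unitary `W` of overlaps. The
relative entropy becomes that of the distributions `l i * |W i j|²` and `m j * |W i j|²`. -/
lemma exists_joint_spectral_data {ρ σ : Op n q} (hρ : IsState ρ) (hσ : IsState σ) :
    ∃ (W : Op n q) (l m : Idx n q → ℝ), (∀ i, 0 ≤ l i) ∧ (∀ j, 0 ≤ m j) ∧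
      W * Wᴴ = 1 ∧ ∑ i, l i = 1 ∧
      ((∀ v : Idx n q → ℂ, σ *ᵥ v = 0 → ρ *ᵥ v = 0) →
        ∀ i j, m j = 0 → l i * Complex.normSq (W i j) = 0) ∧
      (∀ c : ℝ, (c • σ - ρ).PosSemidef →
        (Matrix.diagonal (fun j => ((c * m j : ℝ) : ℂ)) -
          Wᴴ * Matrix.diagonal (fun i => (l i : ℂ)) * W).PosSemidef) ∧
      ((cfc Real.sqrt ρ * cfc Real.sqrt σ).trace.re =
        ∑ i, ∑ j, √(l i) * √(m j) * Complex.normSq (W i j)) ∧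
      ((ρ * cfc Real.log ρ).trace - (ρ * cfc Real.log σ).trace).re =
        ∑ i, ∑ j, l i * Complex.normSq (W i j) * (Real.log (l i) - Real.log (m j)) := by
  obtain ⟨U, l, hU, hU', hl, hρU, hfρ⟩ := exists_spectral_data hρ.1.1
  obtain ⟨V, m, hV, hV', hm, hσV, hfσ⟩ := exists_spectral_data hσ.1.1
  have hWW : (Uᴴ * V) * (Uᴴ * V)ᴴ = 1 := by
    rw [Matrix.conjTranspose_mul, Matrix.conjTranspose_conjTranspose, mul_assoc, ← mul_assoc V,
      hV', one_mul, hU]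
  have hl0 : ∀ i, 0 ≤ l i := fun i => by rw [hl]; exact hρ.1.eigenvalues_nonneg i
  have hm0 : ∀ j, 0 ≤ m j := fun j => by rw [hm]; exact hσ.1.eigenvalues_nonneg j
  have hconj : Vᴴ * ρ * V = (Uᴴ * V)ᴴ * Matrix.diagonal (fun i => (l i : ℂ)) * (Uᴴ * V) := by
    rw [hρU, Matrix.conjTranspose_mul, Matrix.conjTranspose_conjTranspose]
    simp only [mul_assoc]
  have hconj' : Vᴴ * σ * V = Matrix.diagonal (fun i => (m i : ℂ)) := by
    rw [hσV]
    calc Vᴴ * (V * Matrix.diagonal (fun i => (m i : ℂ)) * Vᴴ) * V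
        = (Vᴴ * V) * Matrix.diagonal (fun i => (m i : ℂ)) * (Vᴴ * V) := by simp only [mul_assoc]
      _ = _ := by rw [hV, one_mul, mul_one]
  refine ⟨Uᴴ * V, l, m, hl0, hm0, hWW, ?_, ?_, ?_, ?_, ?_⟩
  · have h := hρ.2
    rw [hρU, trace_conj_diagonal hU] at h
    exact_mod_cast h
  · intro hsupp i j hj
    -- The `j`-th eigenvector of `σ` is in the kernel of `σ`, hence in that of `ρ`.
    have h1 : σ *ᵥ (V *ᵥ Pi.single j 1) = 0 := by
      rw [hσV, Matrix.mulVec_mulVec, mul_assoc, hV, mul_one, ← Matrix.mulVec_mulVec]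
      have : Matrix.diagonal (fun i => (m i : ℂ)) *ᵥ (Pi.single j 1 : Idx n q → ℂ) = 0 := by
        ext k
        rw [Matrix.mulVec_diagonal]
        rcases eq_or_ne k j with rfl | hk
        · simp [hj]
        · simp [hk]
      rw [this, Matrix.mulVec_zero]
    have h2 := hsupp _ h1
    have h3 : (Matrix.diagonal (fun i => (l i : ℂ)) * (Uᴴ * V)) *ᵥ
        (Pi.single j 1 : Idx n q → ℂ) = 0 := by
      rw [hρU, Matrix.mulVec_mulVec] at h2
      have h4 := congrArg (fun x => Uᴴ *ᵥ x) h2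
      simp only [Matrix.mulVec_zero, Matrix.mulVec_mulVec] at h4
      rw [← h4]
      congr 1
      rw [mul_assoc U, mul_assoc U, ← mul_assoc Uᴴ, hU, one_mul, mul_assoc]
    have h5 := congrFun h3 i
    rw [Matrix.mulVec_single_one] at h5
    simp only [Matrix.col_apply, Matrix.diagonal_mul, Pi.zero_apply, mul_eq_zero,
      Complex.ofReal_eq_zero] at h5
    rcases h5 with h | h
    · rw [h, zero_mul]
    · rw [h, map_zero, mul_zero]
  · intro c hc
    have h := hc.conjTranspose_mul_mul_same V
    rw [mul_sub, sub_mul, Matrix.mul_smul, Matrix.smul_mul, hconj, hconj'] at h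
    convert h using 2
    ext i j
    rw [Matrix.smul_apply, Matrix.diagonal_apply, Matrix.diagonal_apply]
    split_ifs <;> simp
  · rw [hfρ, hfσ, trace_conj_diagonal_mul_conj_diagonal]
    simp only [← Complex.ofReal_mul, ← Complex.ofReal_sum, Complex.ofReal_re]
  · have h1 : ((U * Matrix.diagonal (fun i => (l i : ℂ)) * Uᴴ) *
        (U * Matrix.diagonal (fun i => (Real.log (l i) : ℂ)) * Uᴴ)) =
        U * Matrix.diagonal (fun i => (l i : ℂ) * (Real.log (l i) : ℂ)) * Uᴴ := by
      rw [← Matrix.diagonal_mul_diagonal]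
      calc _ = U * Matrix.diagonal (fun i => (l i : ℂ)) * (Uᴴ * U) *
            Matrix.diagonal (fun i => (Real.log (l i) : ℂ)) * Uᴴ := by simp only [mul_assoc]
        _ = _ := by rw [hU, mul_one]; simp only [mul_assoc]
    have h2 : (ρ * cfc Real.log ρ).trace = ∑ i, (l i : ℂ) * (Real.log (l i) : ℂ) := by
      rw [← trace_conj_diagonal hU, ← h1, ← hfρ, ← hρU]
    have h3 : (ρ * cfc Real.log σ).trace =
        ∑ i, ∑ j, (l i : ℂ) * (Real.log (m j) : ℂ) * (Complex.normSq ((Uᴴ * V) i j) : ℂ) := by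
      rw [← trace_conj_diagonal_mul_conj_diagonal, ← hfσ, ← hρU]
    rw [h2, h3]
    simp only [← Complex.ofReal_mul, ← Complex.ofReal_sum, ← Complex.ofReal_sub, Complex.ofReal_re]
    rw [← Finset.sum_sub_distrib]
    refine Finset.sum_congr rfl fun i _ => ?_
    have h4 : l i * Real.log (l i) =
        ∑ j, l i * Real.log (l i) * Complex.normSq ((Uᴴ * V) i j) := by
      rw [← Finset.mul_sum, sum_normSq_row hWW, mul_one]
    rw [h4, ← Finset.sum_sub_distrib]
    exact Finset.sum_congr rfl fun j _ => by ring

lemma neg_log_fidelity_le_relEntropy {ρ σ : Op n q} (hρ : IsState ρ) (hσ : IsState σ) :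
    -ENNReal.log (ENNReal.ofReal (fidelity ρ σ)) ≤ relEntropy ρ σ := by
  unfold relEntropy
  split_ifs with hsupp
  · obtain ⟨W, l, m, hl, hm, hW, hl1, hs, -, hsqrt, hent⟩ := exists_joint_spectral_data hρ hσ
    have hw : ∀ i j, 0 ≤ Complex.normSq (W i j) := fun i j => Complex.normSq_nonneg _
    have hp : ∑ i, ∑ j, l i * Complex.normSq (W i j) = 1 := by
      rw [← hl1]
      exact Finset.sum_congr rfl fun i _ => by rw [← Finset.mul_sum, sum_normSq_row hW, mul_one]
    have hK := overlap_pos hw hl hm hp (hs hsupp)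
    have hmain := neg_two_mul_log_overlap_le hw hl hm hp (hs hsupp)
    have hF : (∑ i, ∑ j, √(l i) * √(m j) * Complex.normSq (W i j)) ^ 2 ≤ fidelity ρ σ := by
      rw [fidelity, ← hsqrt]
      exact pow_le_pow_left₀ (hsqrt ▸ hK.le) (re_trace_le_trace_sqrt _) 2
    have hFpos : 0 < fidelity ρ σ := lt_of_lt_of_le (pow_pos hK 2) hF
    rw [ENNReal.log_ofReal_of_pos hFpos, hent, ← EReal.coe_neg, EReal.coe_le_coe_iff]
    refine le_trans ?_ hmain
    rw [neg_le_neg_iff]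
    have := Real.log_le_log (pow_pos hK 2) hF
    rwa [Real.log_pow] at this
  · exact le_top

/-- An upper bound of `ρ` by a multiple of `σ` bounds the relative entropy. The test vector in the
operator inequality is the image of an eigenvector of `ρ` under the inverse of `σ`. -/
lemma relEntropy_le_log {ρ σ : Op n q} (hρ : IsState ρ) (hσ : IsState σ) {c : ℝ≥0}
    (hc : ((c : ℝ) • σ - ρ).PosSemidef) : relEntropy ρ σ ≤ ENNReal.log (c : ℝ≥0∞) := by
  have hc0 : 0 < (c : ℝ) := by
    have h := hc.trace_nonneg
    rw [Matrix.trace_sub, Matrix.trace_smul, hρ.2, hσ.2, sub_nonneg] at h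
    have h1 : (1 : ℂ) ≤ ((c : ℝ) : ℂ) := by simpa using h
    exact lt_of_lt_of_le one_pos (by exact_mod_cast h1)
  have hsupp : ∀ v : Idx n q → ℂ, σ *ᵥ v = 0 → ρ *ᵥ v = 0 := by
    intro v hv
    have h1 := hc.dotProduct_mulVec_nonneg v
    rw [Matrix.sub_mulVec, Matrix.smul_mulVec, hv, smul_zero, zero_sub, dotProduct_neg] at h1
    exact (hρ.1.dotProduct_mulVec_zero_iff v).mp
      (le_antisymm (neg_nonneg.mp h1) (hρ.1.dotProduct_mulVec_nonneg v))
  rw [relEntropy, if_pos hsupp]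
  obtain ⟨W, l, m, hl, hm, hW, hl1, hs, hpsd, -, hent⟩ := exists_joint_spectral_data hρ hσ
  have hw : ∀ i j, 0 ≤ Complex.normSq (W i j) := fun i j => Complex.normSq_nonneg _
  have hp : ∑ i, ∑ j, l i * Complex.normSq (W i j) = 1 := by
    rw [← hl1]
    exact Finset.sum_congr rfl fun i _ => by rw [← Finset.mul_sum, sum_normSq_row hW, mul_one]
  have hbound : ∀ i, l i * ∑ j, Complex.normSq (W i j) / m j ≤ c := by
    intro i
    set s := ∑ j, Complex.normSq (W i j) / m j with hsdef
    have hs0 : 0 ≤ s := Finset.sum_nonneg fun j _ => div_nonneg (hw i j) (hm j)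
    rcases hs0.eq_or_lt with h0 | hspos
    · rw [← h0, mul_zero]; exact c.2
    set x : Idx n q → ℂ := fun j => star (W i j) / (m j : ℂ) with hx
    have hWx : (W *ᵥ x) i = (s : ℂ) := by
      rw [Matrix.mulVec, dotProduct, hsdef]
      push_cast
      refine Finset.sum_congr rfl fun j _ => ?_
      rw [hx, Complex.star_def, ← mul_div_assoc, Complex.mul_conj]
    have h1 := (hpsd c hc).dotProduct_mulVec_nonneg x
    rw [Matrix.sub_mulVec, dotProduct_sub, star_dotProduct_diagonal_mulVec,
      ← Matrix.mulVec_mulVec, ← Matrix.mulVec_mulVec, Matrix.dotProduct_mulVec,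
      ← Matrix.star_mulVec, star_dotProduct_diagonal_mulVec, ← Complex.ofReal_sub] at h1
    have h2 := sub_nonneg.mp (Complex.zero_le_real.mp h1)
    have h3 : ∑ j, (c : ℝ) * m j * Complex.normSq (x j) = c * s := by
      rw [hsdef, Finset.mul_sum]
      refine Finset.sum_congr rfl fun j _ => ?_
      rw [hx, Complex.star_def, Complex.normSq_div, Complex.normSq_conj, Complex.normSq_ofReal]
      rcases eq_or_ne (m j) 0 with h | h
      · simp [h]
      · field_simp
    have h4 : l i * (s * s) ≤ ∑ k, l k * Complex.normSq ((W *ᵥ x) k) := by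
      have := Finset.single_le_sum (f := fun k => l k * Complex.normSq ((W *ᵥ x) k))
        (fun k _ => mul_nonneg (hl k) (Complex.normSq_nonneg _)) (Finset.mem_univ i)
      simpa only [hWx, Complex.normSq_ofReal] using this
    have h5 : (l i * s) * s ≤ c * s := by nlinarith
    exact le_of_mul_le_mul_right h5 hspos
  have hmain := sum_log_sub_log_le hw hl hm hp (hs hsupp) (sum_normSq_row hW) hc0 hbound
  rw [hent, ENNReal.log_of_nnreal (by exact_mod_cast hc0.ne'), EReal.coe_le_coe_iff]
  exact hmain

lemma relEntropy_le_maxRelEntropy {ρ σ : Op n q} (hρ : IsState ρ) (hσ : IsState σ) :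
    relEntropy ρ σ ≤ maxRelEntropy ρ σ := by
  unfold maxRelEntropy
  simp only [← ENNReal.logOrderIso_apply, OrderIso.map_iInf]
  exact le_iInf fun c => le_iInf fun hc => relEntropy_le_log hρ hσ hc

end Entropies

/-! ### Comparison of the five monotones -/

section Chain

variable {n q : ℕ} [NeZero q]

lemma convex_isState : Convex ℝ {σ : Op n q | IsState σ} := by
  intro σ hσ τ hτ a b ha hb hab
  refine ⟨(hσ.1.smul ha).add (hτ.1.smul hb), ?_⟩
  rw [Matrix.trace_add, Matrix.trace_smul, Matrix.trace_smul, hσ.2, hτ.2, ← add_smul, hab,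
    one_smul]

lemma isState_vecMulVec {ψ : Idx n q → ℂ} (h : star ψ ⬝ᵥ ψ = 1) :
    IsState (Matrix.vecMulVec ψ (star ψ)) := by
  refine ⟨Matrix.posSemidef_vecMulVec_self_star ψ, ?_⟩
  rw [Matrix.trace_vecMulVec, dotProduct_comm, h]

lemma isState_of_mem_stabMixtures {σ : Op n q} (h : σ ∈ stabMixtures n q) : IsState σ := by
  refine convexHull_min ?_ convex_isState h
  rintro _ ⟨ψ, hψ, rfl⟩
  exact isState_vecMulVec hψ.1

lemma logStabFidelity_le_relEntropyMagic {ρ : Op n q} (hρ : IsState ρ) :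
    logStabFidelity ρ ≤ relEntropyMagic ρ := by
  refine le_iInf₂ fun σ hσ => ?_
  refine le_trans ?_ (neg_log_fidelity_le_relEntropy hρ (isState_of_mem_stabMixtures hσ))
  rw [logStabFidelity, EReal.neg_le_neg_iff]
  exact ENNReal.log_monotone (le_iSup₂ (f := fun σ _ => ENNReal.ofReal (fidelity ρ σ)) σ hσ)

lemma relEntropyMagic_le_maxRelEntropyMagic {ρ : Op n q} (hρ : IsState ρ) :
    relEntropyMagic ρ ≤ maxRelEntropyMagic ρ :=
  iInf₂_mono fun _ hσ => relEntropy_le_maxRelEntropy hρ (isState_of_mem_stabMixtures hσ)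

/-- A decomposition `ρ = (1 + s) σ' - s σ` gives `ρ ≼ (1 + s) σ'`. -/
lemma maxRelEntropyMagic_le_logGenRobustness (ρ : Op n q) :
    maxRelEntropyMagic ρ ≤ logGenRobustness ρ := by
  have key : ∀ s : ℝ≥0, (∃ σ' ∈ stabMixtures n q, ∃ σ : Op n q, IsState σ ∧
      ρ = (1 + (s : ℝ)) • σ' - (s : ℝ) • σ) →
      maxRelEntropyMagic ρ ≤ ENNReal.log (1 + (s : ℝ≥0∞)) := by
    rintro s ⟨σ', hσ', σ, hσ, h⟩
    refine (iInf₂_le σ' hσ').trans (ENNReal.log_monotone ?_)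
    have hpsd : ((((1 + s : ℝ≥0) : ℝ)) • σ' - ρ).PosSemidef := by
      have : (((1 + s : ℝ≥0) : ℝ)) • σ' - ρ = (s : ℝ) • σ := by
        rw [h]
        push_cast
        abel
      rw [this]
      exact hσ.1.smul s.2
    exact (iInf₂_le (1 + s) hpsd).trans_eq (by push_cast; rfl)
  obtain ⟨y, hy⟩ := ENNReal.log_surjective (maxRelEntropyMagic ρ)
  rw [← hy] at key ⊢
  refine ENNReal.log_monotone ?_
  have h1 : y - 1 ≤ genRobustness ρ :=
    le_iInf₂ fun s hs => tsub_le_iff_left.mpr (ENNReal.log_le_log_iff.mp (key s hs))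
  calc y ≤ 1 + genRobustness ρ := tsub_le_iff_left.mp h1
    _ ≤ 1 + 2 * genRobustness ρ := by
      gcongr
      exact le_mul_of_one_le_left zero_le (by norm_num)

lemma logGenRobustness_le_logRobustness (ρ : Op n q) : logGenRobustness ρ ≤ logRobustness ρ := by
  refine ENNReal.log_monotone ?_
  gcongr
  refine le_iInf₂ fun s hs => ?_
  obtain ⟨σ', hσ', σ, hσ, h⟩ := hs
  exact iInf₂_le s ⟨σ', hσ', σ, isState_of_mem_stabMixtures hσ, h⟩

end Chain

/-! ### The Pauli operators `Z ^ a X ^ b` as an orthogonal operator basis -/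

section Pauli

variable {n q : ℕ} [NeZero q]

/-- The discrete phase space: `(a, b)` labels the Pauli operator `Z ^ a X ^ b`. -/
abbrev Phase (n q : ℕ) : Type := Idx n q × Idx n q

/-- The symplectic form of the discrete phase space. -/
def sympForm (v w : Phase n q) : ZMod q := v.1 ⬝ᵥ w.2 - w.1 ⬝ᵥ v.2

section

omit [NeZero q]

lemma sympForm_self (v : Phase n q) : sympForm v v = 0 := by
  rw [sympForm, sub_self]

lemma sympForm_neg_swap (v w : Phase n q) : -sympForm v w = sympForm w v := by
  rw [sympForm, sympForm, neg_sub]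

lemma sympForm_add_left (u v w : Phase n q) :
    sympForm (u + v) w = sympForm u w + sympForm v w := by
  simp only [sympForm, Prod.fst_add, Prod.snd_add, add_dotProduct, dotProduct_add]
  ring

lemma sympForm_add_right (u v w : Phase n q) :
    sympForm u (v + w) = sympForm u v + sympForm u w := by
  simp only [sympForm, Prod.fst_add, Prod.snd_add, add_dotProduct, dotProduct_add]
  ring

lemma sympForm_smul_left (c : ZMod q) (v w : Phase n q) :
    sympForm (c • v) w = c * sympForm v w := by
  simp only [sympForm, Prod.smul_fst, Prod.smul_snd, smul_dotProduct, dotProduct_smul, smul_eq_mul]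
  ring

lemma sympForm_smul_right (c : ZMod q) (v w : Phase n q) :
    sympForm v (c • w) = c * sympForm v w := by
  simp only [sympForm, Prod.smul_fst, Prod.smul_snd, smul_dotProduct, dotProduct_smul, smul_eq_mul]
  ring

lemma sympForm_neg_right (v w : Phase n q) : sympForm v (-w) = -sympForm v w := by
  rw [← neg_one_smul (ZMod q), sympForm_smul_right, neg_one_mul]

end

/-- The Pauli operator `Z ^ a X ^ b`, given by its matrix entries. -/
noncomputable def pauli (v : Phase n q) : Op n q :=
  Matrix.of fun x y => if x = y + v.2 then ZMod.stdAddChar (v.1 ⬝ᵥ x) else 0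

lemma pauli_apply (v : Phase n q) (x y : Idx n q) :
    pauli v x y = if x = y + v.2 then ZMod.stdAddChar (v.1 ⬝ᵥ x) else 0 := rfl

lemma stdAddChar_eq_omega_pow (j : ZMod q) : ZMod.stdAddChar j = omega q ^ j.val := by
  rw [ZMod.stdAddChar_apply, ZMod.toCircle_apply, omega, ← Complex.exp_nat_mul]
  congr 1
  ring

lemma stdAddChar_sum {ι : Type*} (s : Finset ι) (f : ι → ZMod q) :
    (ZMod.stdAddChar (∑ i ∈ s, f i) : ℂ) = ∏ i ∈ s, ZMod.stdAddChar (f i) := by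
  classical
  induction s using Finset.induction_on with
  | empty => simp
  | insert i s hi ih => rw [Finset.sum_insert hi, Finset.prod_insert hi, AddChar.map_add_eq_mul, ih]

lemma conj_stdAddChar (j : ZMod q) :
    (starRingEnd ℂ) (ZMod.stdAddChar j) = ZMod.stdAddChar (-j) := by
  rw [ZMod.stdAddChar_apply, ZMod.stdAddChar_apply, AddChar.map_neg_eq_inv,
    Circle.coe_inv_eq_conj]

lemma shiftX_pow_apply (k : ℕ) (i j : ZMod q) :
    (shiftX q ^ k) i j = if i = j + (k : ZMod q) then 1 else 0 := by
  induction k generalizing i j with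
  | zero => simp [Matrix.one_apply]
  | succ k ih =>
    rw [pow_succ, Matrix.mul_apply]
    have h : ∀ m : ZMod q, shiftX q m j = if m = j + 1 then 1 else 0 := fun _ => rfl
    simp only [ih, h, mul_ite, mul_one, mul_zero]
    rw [Finset.sum_ite_eq' Finset.univ (j + 1), if_pos (Finset.mem_univ _)]
    push_cast
    rw [add_assoc, add_comm (1 : ZMod q)]

lemma pauli_eq_tensorOp (v : Phase n q) :
    pauli v = tensorOp fun i => clockZ q ^ (v.1 i).val * shiftX q ^ (v.2 i).val := by
  ext x y
  simp only [tensorOp, Matrix.of_apply, clockZ, Matrix.diagonal_pow, Matrix.diagonal_mul,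
    shiftX_pow_apply, Pi.pow_apply, ZMod.natCast_val, ZMod.cast_id', id, mul_ite, mul_one, mul_zero]
  rw [pauli_apply]
  by_cases h : x = y + v.2
  · rw [if_pos h, dotProduct, stdAddChar_sum]
    refine Finset.prod_congr rfl fun i _ => ?_
    rw [if_pos (show x i = y i + v.2 i from congrFun h i), ← stdAddChar_eq_omega_pow,
      ← AddChar.map_nsmul_eq_pow]
    congr 1
    rw [nsmul_eq_mul, ZMod.natCast_val, ZMod.cast_id', id]
  · rw [if_neg h]
    obtain ⟨i, hi⟩ := Function.ne_iff.mp h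
    exact (Finset.prod_eq_zero (Finset.mem_univ i) (if_neg hi)).symm

lemma pauli_mul (v w : Phase n q) :
    pauli v * pauli w = ZMod.stdAddChar (-(w.1 ⬝ᵥ v.2)) • pauli (v + w) := by
  ext x y
  rw [Matrix.mul_apply, Matrix.smul_apply]
  simp only [pauli_apply, mul_ite, mul_zero]
  rw [Finset.sum_ite_eq' Finset.univ (y + w.2), if_pos (Finset.mem_univ _)]
  have hiff : x = y + w.2 + v.2 ↔ x = y + (v + w).2 := by
    rw [Prod.snd_add, add_assoc, add_comm w.2]
  by_cases h : x = y + w.2 + v.2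
  · rw [if_pos h, if_pos (hiff.mp h), smul_eq_mul, ← AddChar.map_add_eq_mul,
      ← AddChar.map_add_eq_mul]
    congr 1
    rw [h]
    simp only [Prod.fst_add, add_dotProduct, dotProduct_add]
    ring
  · rw [if_neg h, if_neg (fun h' => h (hiff.mpr h')), zero_mul, smul_zero]

lemma pauli_zero : pauli (0 : Phase n q) = 1 := by
  ext x y
  simp [pauli_apply, Matrix.one_apply]

lemma pauli_commute {v w : Phase n q} (h : sympForm v w = 0) : Commute (pauli v) (pauli w) := by
  rw [Commute, SemiconjBy, pauli_mul, pauli_mul, add_comm w v]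
  rw [sympForm, sub_eq_zero] at h
  rw [h]

lemma conjTranspose_pauli (v : Phase n q) :
    (pauli v)ᴴ = ZMod.stdAddChar (-(v.1 ⬝ᵥ v.2)) • pauli (-v) := by
  ext x y
  rw [Matrix.conjTranspose_apply, Matrix.smul_apply, pauli_apply, pauli_apply]
  have hiff : y = x + v.2 ↔ x = y + (-v).2 := by
    rw [Prod.snd_neg, ← sub_eq_add_neg, eq_sub_iff_add_eq, eq_comm]
  by_cases h : y = x + v.2
  · rw [if_pos h, if_pos (hiff.mp h), smul_eq_mul, ← AddChar.map_add_eq_mul, Complex.star_def,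
      conj_stdAddChar, h]
    congr 1
    simp only [Prod.fst_neg, neg_dotProduct, dotProduct_add]
    ring
  · rw [if_neg h, if_neg (fun h' => h (hiff.mpr h')), star_zero, smul_zero]

lemma conjTranspose_pauli_mul_pauli_self (v : Phase n q) : (pauli v)ᴴ * pauli v = 1 := by
  rw [conjTranspose_pauli, Matrix.smul_mul, pauli_mul, smul_smul, ← AddChar.map_add_eq_mul,
    neg_add_cancel, pauli_zero, Prod.snd_neg, dotProduct_neg, neg_neg, neg_add_cancel,
    AddChar.map_zero_eq_one, one_smul]

lemma pauli_mul_conjTranspose_pauli_self (v : Phase n q) : pauli v * (pauli v)ᴴ = 1 :=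
  mul_eq_one_comm.mp (conjTranspose_pauli_mul_pauli_self v)

/-- The Pauli operator as an element of the group of invertible operators. -/
noncomputable def pauliUnit (v : Phase n q) : (Op n q)ˣ :=
  ⟨pauli v, (pauli v)ᴴ, pauli_mul_conjTranspose_pauli_self v, conjTranspose_pauli_mul_pauli_self v⟩

lemma pauliUnit_mem_pauliGroup (v : Phase n q) : pauliUnit v ∈ pauliGroup n q :=
  Subgroup.subset_closure (Or.inr ⟨_, _, pauli_eq_tensorOp v⟩)

lemma sum_stdAddChar_dotProduct (z : Idx n q) :
    ∑ a : Idx n q, ZMod.stdAddChar (a ⬝ᵥ z) = if z = 0 then (q : ℂ) ^ n else 0 := by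
  simp only [dotProduct, stdAddChar_sum]
  rw [← Fintype.prod_sum (fun i (a : ZMod q) => ZMod.stdAddChar (a * z i))]
  simp only [AddChar.sum_mulShift _ (ZMod.isPrimitive_stdAddChar q), ZMod.card]
  by_cases h : z = 0
  · simp [h]
  · obtain ⟨i, hi⟩ := Function.ne_iff.mp h
    rw [if_neg h]
    refine Finset.prod_eq_zero (Finset.mem_univ i) ?_
    rw [if_neg (show ¬z i = 0 from hi), Nat.cast_zero]

lemma trace_pauli (v : Phase n q) : (pauli v).trace = if v = 0 then (q : ℂ) ^ n else 0 := by
  simp only [Matrix.trace, Matrix.diag, pauli_apply, left_eq_add]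
  by_cases h2 : v.2 = 0
  · simp only [h2, if_true, dotProduct_comm v.1]
    rw [sum_stdAddChar_dotProduct]
    simp only [Prod.ext_iff, h2, Prod.fst_zero, Prod.snd_zero, and_true]
  · simp only [h2, if_false, Finset.sum_const_zero]
    rw [if_neg (fun h => h2 (by rw [h]; rfl))]

lemma trace_conjTranspose_pauli_mul_pauli (v w : Phase n q) :
    ((pauli v)ᴴ * pauli w).trace = if v = w then (q : ℂ) ^ n else 0 := by
  by_cases h : v = w
  · subst h
    rw [conjTranspose_pauli_mul_pauli_self, if_pos rfl, Matrix.trace_one]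
    simp [ZMod.card]
  · rw [if_neg h, conjTranspose_pauli, Matrix.smul_mul, pauli_mul, Matrix.trace_smul,
      Matrix.trace_smul, trace_pauli, if_neg, smul_zero, smul_zero]
    rwa [neg_add_eq_zero]

/-- The completeness relation of the Pauli operators. -/
lemma sum_conj_pauli_mul_pauli (x y x' y' : Idx n q) :
    ∑ v : Phase n q, star (pauli v x y) * pauli v x' y' =
      if x = x' ∧ y = y' then (q : ℂ) ^ n else 0 := by
  rw [Fintype.sum_prod_type_right]
  have h1 : ∀ b : Idx n q, ∑ a : Idx n q, star (pauli (a, b) x y) * pauli (a, b) x' y' =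
      if x = y + b ∧ x' = y' + b then (if x' - x = 0 then (q : ℂ) ^ n else 0) else 0 := by
    intro b
    simp only [pauli_apply]
    by_cases hx : x = y + b
    · by_cases hx' : x' = y' + b
      · simp only [if_pos hx, if_pos hx', if_pos (And.intro hx hx')]
        rw [← sum_stdAddChar_dotProduct]
        refine Finset.sum_congr rfl fun a _ => ?_
        rw [Complex.star_def, conj_stdAddChar, ← AddChar.map_add_eq_mul, dotProduct_sub]
        congr 1
        ring
      · simp [hx']
    · simp [hx]
  simp only [h1]
  by_cases h : x = x' ∧ y = y'
  · obtain ⟨rfl, rfl⟩ := h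
    simp only [and_self, sub_self, if_true]
    have h2 : ∀ b : Idx n q, (x = y + b) ↔ (b = x - y) := fun b => by
      rw [eq_sub_iff_add_eq, add_comm, eq_comm]
    simp only [h2, Finset.sum_ite_eq', Finset.mem_univ, if_true]
  · rw [if_neg h]
    refine Finset.sum_eq_zero fun b _ => ?_
    split_ifs with h3 h4
    · exfalso
      apply h
      have hxx : x = x' := (sub_eq_zero.mp h4).symm
      refine ⟨hxx, ?_⟩
      have := h3.1.symm.trans (hxx.trans h3.2)
      exact add_right_cancel this
    · rfl
    · rfl

/-- The coefficient of `ρ` at the Pauli operator labelled by `v` (its characteristic function). -/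
noncomputable def pauliCoeff (ρ : Op n q) (v : Phase n q) : ℂ := ((pauli v)ᴴ * ρ).trace

lemma pauliCoeff_eq_sum (ρ : Op n q) (v : Phase n q) :
    pauliCoeff ρ v = ∑ x, ∑ y, star (pauli v x y) * ρ x y := by
  rw [pauliCoeff, Matrix.trace, Finset.sum_comm]
  refine Finset.sum_congr rfl fun y _ => ?_
  rw [Matrix.diag, Matrix.mul_apply]
  rfl

lemma sum_pauliCoeff_smul_pauli (ρ : Op n q) :
    ∑ v, pauliCoeff ρ v • pauli v = ((q : ℂ) ^ n) • ρ := by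
  ext x' y'
  rw [Matrix.sum_apply, Matrix.smul_apply]
  simp only [Matrix.smul_apply, smul_eq_mul, pauliCoeff_eq_sum, Finset.sum_mul]
  rw [Finset.sum_comm]
  have : ∀ x, ∑ v, ∑ y, star (pauli v x y) * ρ x y * pauli v x' y' =
      ∑ y, ρ x y * if x = x' ∧ y = y' then (q : ℂ) ^ n else 0 := by
    intro x
    rw [Finset.sum_comm]
    refine Finset.sum_congr rfl fun y _ => ?_
    rw [← sum_conj_pauli_mul_pauli, Finset.mul_sum]
    exact Finset.sum_congr rfl fun v _ => by ring
  simp only [this, ite_and, mul_ite, mul_zero]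
  simp only [Finset.sum_ite_eq', Finset.mem_univ, if_true, Finset.sum_ite_irrel,
    Finset.sum_const_zero]
  ring

lemma sum_normSq_pauliCoeff (ρ : Op n q) :
    ((∑ v, Complex.normSq (pauliCoeff ρ v) : ℝ) : ℂ) = (q : ℂ) ^ n * (ρᴴ * ρ).trace := by
  rw [← smul_eq_mul, ← Matrix.trace_smul, ← Matrix.mul_smul, ← sum_pauliCoeff_smul_pauli,
    Finset.mul_sum, Matrix.trace_sum]
  push_cast
  refine Finset.sum_congr rfl fun v _ => ?_
  rw [Matrix.mul_smul, Matrix.trace_smul, smul_eq_mul, ← Complex.mul_conj]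
  congr 1
  rw [pauliCoeff, ← Complex.star_def, ← Matrix.trace_conjTranspose, Matrix.conjTranspose_mul,
    Matrix.conjTranspose_conjTranspose]

/-- The purity `Tr ρ²` of a state is at most `1`. -/
lemma sum_normSq_pauliCoeff_le {ρ : Op n q} (hρ : IsState ρ) :
    ∑ v, Complex.normSq (pauliCoeff ρ v) ≤ (q : ℝ) ^ n := by
  obtain ⟨U, l, hU, -, hl, hρU, -⟩ := exists_spectral_data hρ.1.1
  have hl0 : ∀ i, 0 ≤ l i := fun i => by rw [hl]; exact hρ.1.eigenvalues_nonneg i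
  have hl1 : ∑ i, l i = 1 := by
    have h := hρ.2
    rw [hρU, trace_conj_diagonal hU] at h
    exact_mod_cast h
  have h := sum_normSq_pauliCoeff ρ
  rw [hρ.1.1.eq, hρU] at h
  have h2 : ((U * Matrix.diagonal (fun i => (l i : ℂ)) * Uᴴ) *
      (U * Matrix.diagonal (fun i => (l i : ℂ)) * Uᴴ)) =
      U * Matrix.diagonal (fun i => (l i : ℂ) * (l i : ℂ)) * Uᴴ := by
    rw [← Matrix.diagonal_mul_diagonal]
    calc _ = U * Matrix.diagonal (fun i => (l i : ℂ)) * (Uᴴ * U) *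
          Matrix.diagonal (fun i => (l i : ℂ)) * Uᴴ := by simp only [mul_assoc]
      _ = _ := by rw [hU, mul_one]; simp only [mul_assoc]
  rw [h2, trace_conj_diagonal hU, ← hρU] at h
  have h3 : ∑ v, Complex.normSq (pauliCoeff ρ v) = (q : ℝ) ^ n * ∑ i, l i * l i := by
    exact_mod_cast h
  rw [h3]
  refine mul_le_of_le_one_right (by positivity) ?_
  calc ∑ i, l i * l i ≤ ∑ i, l i * 1 := by
        refine Finset.sum_le_sum fun i _ => mul_le_mul_of_nonneg_left ?_ (hl0 i)
        rw [← hl1]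
        exact Finset.single_le_sum (f := l) (fun j _ => hl0 j) (Finset.mem_univ i)
    _ = 1 := by simp [hl1]

lemma pauliCoeff_zero {ρ : Op n q} (hρ : IsState ρ) : pauliCoeff ρ 0 = 1 := by
  rw [pauliCoeff, pauli_zero, Matrix.conjTranspose_one, one_mul, hρ.2]

end Pauli

/-! ### Stabilizer bases -/

section Diagonalization

variable {ι κ : Type*} [Fintype ι] [DecidableEq ι]

open Module.End in
/-- Commuting Hermitian matrices are simultaneously diagonalized by a unitary matrix. -/
lemma exists_unitary_mul_eq_mul_diagonal {T : κ → Matrix ι ι ℂ} (hT : ∀ k, (T k).IsHermitian)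
    (hC : ∀ k l, Commute (T k) (T l)) :
    ∃ U : Matrix ι ι ℂ, Uᴴ * U = 1 ∧
      ∃ χ : κ → ι → ℂ, ∀ k, T k * U = U * Matrix.diagonal (χ k) := by
  classical
  set L : κ → EuclideanSpace ℂ ι →ₗ[ℂ] EuclideanSpace ℂ ι := fun k => Matrix.toEuclideanLin (T k)
    with hL
  have hsymm : ∀ k, (L k).IsSymmetric := fun k => Matrix.isSymmetric_toEuclideanLin_iff.mpr (hT k)
  have hcomm : Pairwise (Function.onFun Commute L) := by
    intro k l _
    refine LinearMap.ext fun v => ?_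
    simp only [hL, Module.End.mul_apply, Matrix.toLpLin_apply, Matrix.mulVec_mulVec]
    rw [(hC k l).eq]
  have hint := LinearMap.IsSymmetric.directSum_isInternal_of_pairwise_commute hsymm hcomm
  have horth := LinearMap.IsSymmetric.orthogonalFamily_iInf_eigenspaces hsymm
  -- Only finitely many joint eigenspaces are nonzero.
  have hfin : Finite {γ : κ → ℂ // (⨅ j, eigenspace (L j) (γ j)) ≠ ⊥} :=
    WellFoundedGT.finite_ne_bot_of_iSupIndep hint.submodule_iSupIndep
  have := Fintype.ofFinite {γ : κ → ℂ // (⨅ j, eigenspace (L j) (γ j)) ≠ ⊥}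
  have hint' := DirectSum.isInternal_ne_bot_iff.mpr hint
  have horth' := horth.comp (γ := {γ : κ → ℂ // (⨅ j, eigenspace (L j) (γ j)) ≠ ⊥})
    Subtype.val_injective
  have hn : Module.finrank ℂ (EuclideanSpace ℂ ι) = Fintype.card ι := finrank_euclideanSpace
  set e := Fintype.equivFin ι
  set b := (hint'.subordinateOrthonormalBasis hn horth').reindex e.symm with hb
  refine ⟨Matrix.of fun x i => b i x, ?_,
    fun k i => (hint'.subordinateOrthonormalBasisIndex hn (e i) horth').1 k, fun k => ?_⟩
  · ext i j
    have h := orthonormal_iff_ite.mp b.orthonormal i j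
    rw [EuclideanSpace.inner_eq_star_dotProduct, dotProduct_comm] at h
    rw [Matrix.mul_apply, Matrix.one_apply, ← h]
    rfl
  · ext x i
    have hmem := hint'.subordinateOrthonormalBasis_subordinate hn (e i) horth'
    have hmem' := (Submodule.mem_iInf _).mp hmem k
    rw [mem_eigenspace_iff] at hmem'
    have hbi : b i = hint'.subordinateOrthonormalBasis hn horth' (e i) := by
      rw [hb, OrthonormalBasis.reindex_apply, Equiv.symm_symm]
    rw [← hbi] at hmem'
    have h := congrArg (fun v : EuclideanSpace ℂ ι => v x) hmem'
    simp only [hL, Matrix.toLpLin_apply, PiLp.smul_apply, smul_eq_mul] at h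
    rw [Matrix.mul_diagonal, mul_comm]
    exact h

end Diagonalization

section StabilizerBasis

variable {n q : ℕ} [NeZero q]

/-- Commuting Pauli operators are simultaneously diagonalized by a unitary matrix, as their
Hermitian and skew-Hermitian parts are. -/
lemma exists_unitary_pauli_mul_eq {κ : Type*} {f : κ → Phase n q}
    (hf : ∀ a b, sympForm (f a) (f b) = 0) :
    ∃ U : Op n q, Uᴴ * U = 1 ∧
      ∃ χ : κ → Idx n q → ℂ, ∀ a, pauli (f a) * U = U * Matrix.diagonal (χ a) := by
  have hadj : ∀ a b, Commute (pauli (f a)) (pauli (f b))ᴴ := by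
    intro a b
    rw [conjTranspose_pauli]
    refine (pauli_commute ?_).smul_right _
    rw [sympForm_neg_right, hf, neg_zero]
  have hc : ∀ a b, Commute (pauli (f a)) (pauli (f b)) := fun a b => pauli_commute (hf a b)
  have hadj' : ∀ a b, Commute (pauli (f a))ᴴ (pauli (f b)) := fun a b => (hadj b a).symm
  have hcc : ∀ a b, Commute (pauli (f a))ᴴ (pauli (f b))ᴴ := by
    intro a b
    have := congrArg Matrix.conjTranspose (hc b a).eq
    rwa [Matrix.conjTranspose_mul, Matrix.conjTranspose_mul] at this
  let T : κ ⊕ κ → Op n q := Sum.elim (fun a => pauli (f a) + (pauli (f a))ᴴ)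
    (fun a => Complex.I • (pauli (f a) - (pauli (f a))ᴴ))
  obtain ⟨U, hU, χ, hχ⟩ := exists_unitary_mul_eq_mul_diagonal (T := T) (by
      rintro (a | a)
      · change (_)ᴴ = _
        simp [T, add_comm]
      · change (_)ᴴ = _
        simp [T, ← smul_neg]) (by
      have h1 : ∀ a b, Commute (pauli (f a) + (pauli (f a))ᴴ) (pauli (f b) + (pauli (f b))ᴴ) :=
        fun a b => ((hc a b).add_right (hadj a b)).add_left ((hadj' a b).add_right (hcc a b))
      have h2 : ∀ a b, Commute (pauli (f a) + (pauli (f a))ᴴ) (pauli (f b) - (pauli (f b))ᴴ) :=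
        fun a b => ((hc a b).sub_right (hadj a b)).add_left ((hadj' a b).sub_right (hcc a b))
      have h3 : ∀ a b, Commute (pauli (f a) - (pauli (f a))ᴴ) (pauli (f b) - (pauli (f b))ᴴ) :=
        fun a b => ((hc a b).sub_right (hadj a b)).sub_left ((hadj' a b).sub_right (hcc a b))
      rintro (a | a) (b | b)
      · exact h1 a b
      · exact (h2 a b).smul_right _
      · exact ((h2 b a).symm).smul_left _
      · exact ((h3 a b).smul_left _).smul_right _)
  refine ⟨U, hU, fun a i => (1 / 2) * (χ (Sum.inl a) i - Complex.I * χ (Sum.inr a) i), fun a => ?_⟩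
  have hsum : pauli (f a) = (1 / 2 : ℂ) • (T (Sum.inl a) - Complex.I • T (Sum.inr a)) := by
    simp only [T, Sum.elim_inl, Sum.elim_inr, smul_smul, Complex.I_mul_I]
    module
  rw [hsum, Matrix.smul_mul, sub_mul, Matrix.smul_mul, hχ, hχ]
  ext x i
  simp only [Matrix.smul_apply, Matrix.sub_apply, Matrix.mul_diagonal, smul_eq_mul]
  ring

/-- The eigenvalue lists of distinct commuting Pauli operators are orthogonal, because the operators
are. -/
lemma sum_star_mul_eigenvalues_row {f : Idx n q → Phase n q} (hinj : Function.Injective f)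
    {U : Op n q} (hU : Uᴴ * U = 1) {χ : Idx n q → Idx n q → ℂ}
    (hχ : ∀ a, pauli (f a) * U = U * Matrix.diagonal (χ a)) (a b : Idx n q) :
    ∑ i, star (χ a i) * χ b i = if a = b then (q : ℂ) ^ n else 0 := by
  have hU' : U * Uᴴ = 1 := mul_eq_one_comm.mp hU
  have hp : ∀ a, pauli (f a) = U * Matrix.diagonal (χ a) * Uᴴ := fun a => by
    rw [← hχ, mul_assoc, hU', mul_one]
  have h := trace_conjTranspose_pauli_mul_pauli (f a) (f b)
  have h2 : (pauli (f a))ᴴ * pauli (f b) =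
      U * Matrix.diagonal (fun i => star (χ a i) * χ b i) * Uᴴ := by
    rw [hp, hp, Matrix.conjTranspose_mul, Matrix.conjTranspose_mul,
      Matrix.conjTranspose_conjTranspose, Matrix.diagonal_conjTranspose]
    calc _ = U * Matrix.diagonal (star (χ a)) * (Uᴴ * U) * Matrix.diagonal (χ b) * Uᴴ := by
          simp only [mul_assoc]
      _ = _ := by
          rw [hU, mul_one, mul_assoc U, Matrix.diagonal_mul_diagonal]
          rfl
  rw [h2, trace_conj_diagonal hU] at h
  rw [h]
  exact if_congr hinj.eq_iff rfl rfl

/-- Different joint eigenvectors of `q ^ n` distinct commuting Pauli operators have orthogonal lists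
of eigenvalues: a square matrix with orthogonal rows of equal norm has orthogonal columns. -/
lemma sum_star_mul_eigenvalues_col {f : Idx n q → Phase n q} (hinj : Function.Injective f)
    {U : Op n q} (hU : Uᴴ * U = 1) {χ : Idx n q → Idx n q → ℂ}
    (hχ : ∀ a, pauli (f a) * U = U * Matrix.diagonal (χ a)) (i j : Idx n q) :
    ∑ a, star (χ a i) * χ a j = if i = j then (q : ℂ) ^ n else 0 := by
  have hd : ((q : ℂ) ^ n) ≠ 0 := pow_ne_zero _ (Nat.cast_ne_zero.mpr (NeZero.ne q))
  set X : Op n q := Matrix.of χ with hX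
  have hrow : X * Xᴴ = ((q : ℂ) ^ n) • (1 : Op n q) := by
    ext a b
    rw [Matrix.mul_apply, Matrix.smul_apply, Matrix.one_apply]
    calc ∑ i, X a i * Xᴴ i b = ∑ i, star (χ b i) * χ a i :=
          Finset.sum_congr rfl fun i _ => mul_comm _ _
      _ = _ := by
          rw [sum_star_mul_eigenvalues_row hinj hU hχ, eq_comm]
          simp only [eq_comm, smul_eq_mul, mul_ite, mul_one, mul_zero]
  have hcol : Xᴴ * X = ((q : ℂ) ^ n) • (1 : Op n q) := by
    have h1 : X * (((q : ℂ) ^ n)⁻¹ • Xᴴ) = 1 := by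
      rw [Matrix.mul_smul, hrow, smul_smul, inv_mul_cancel₀ hd, one_smul]
    have h2 := mul_eq_one_comm.mp h1
    rw [Matrix.smul_mul] at h2
    rw [← h2, smul_smul, mul_inv_cancel₀ hd, one_smul]
  have h := congrFun (congrFun hcol i) j
  rw [Matrix.mul_apply, Matrix.smul_apply, Matrix.one_apply] at h
  calc ∑ a, star (χ a i) * χ a j = ∑ a, Xᴴ i a * X a j := rfl
    _ = _ := by
      rw [h]
      split_ifs <;> simp

/-- The joint eigenvectors of `q ^ n` distinct commuting Pauli operators are stabilizer states. -/
lemma isPureStabilizer_col {f : Idx n q → Phase n q} (hinj : Function.Injective f)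
    (hf : ∀ a b, sympForm (f a) (f b) = 0)
    {U : Op n q} (hU : Uᴴ * U = 1) {χ : Idx n q → Idx n q → ℂ}
    (hχ : ∀ a, pauli (f a) * U = U * Matrix.diagonal (χ a)) (i : Idx n q) :
    IsPureStabilizer (U.col i) := by
  have hd : ((q : ℂ) ^ n) ≠ 0 := pow_ne_zero _ (Nat.cast_ne_zero.mpr (NeZero.ne q))
  have hU' : U * Uᴴ = 1 := mul_eq_one_comm.mp hU
  have hunit : star (U.col i) ⬝ᵥ U.col i = 1 := by
    have h := congrFun (congrFun hU i) i
    rw [Matrix.mul_apply, Matrix.one_apply_eq] at h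
    exact h
  have heig : ∀ a, pauli (f a) *ᵥ U.col i = χ a i • U.col i := by
    intro a
    ext x
    have h := congrFun (congrFun (hχ a) x) i
    rw [Matrix.mul_diagonal, mul_comm] at h
    exact h
  set G : Subgroup (Op n q)ˣ := Subgroup.closure (Set.range fun a => pauliUnit (f a)) with hG
  have hgen : ∀ a, pauliUnit (f a) ∈ G := fun a => Subgroup.subset_closure ⟨a, rfl⟩
  -- Every element of the generated group has the column as an eigenvector.
  have hGeig : ∀ P ∈ G, ∃ c : ℂ, (P : Op n q) *ᵥ U.col i = c • U.col i := by
    intro P hP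
    induction hP using Subgroup.closure_induction with
    | mem P hP =>
      obtain ⟨a, rfl⟩ := hP
      exact ⟨_, heig a⟩
    | one => exact ⟨1, by simp⟩
    | mul P Q _ _ hP hQ =>
      obtain ⟨c, hc⟩ := hP
      obtain ⟨c', hc'⟩ := hQ
      exact ⟨c' * c, by rw [Units.val_mul, ← Matrix.mulVec_mulVec, hc', Matrix.mulVec_smul, hc,
        smul_smul]⟩
    | inv P _ hP =>
      obtain ⟨c, hc⟩ := hP
      have h1 : ((P⁻¹ : (Op n q)ˣ) : Op n q) *ᵥ ((P : Op n q) *ᵥ U.col i) = U.col i := by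
        rw [Matrix.mulVec_mulVec, ← Units.val_mul, inv_mul_cancel, Units.val_one,
          Matrix.one_mulVec]
      rw [hc, Matrix.mulVec_smul] at h1
      have hc0 : c ≠ 0 := by
        rintro rfl
        rw [zero_smul] at h1
        rw [← h1] at hunit
        simp at hunit
      exact ⟨c⁻¹, by rw [eq_inv_smul_iff₀ hc0]; exact h1⟩
  refine ⟨hunit, G, ?_, ?_, fun P => star (U.col i) ⬝ᵥ ((P : Op n q) *ᵥ U.col i), ?_⟩
  · rw [hG, Subgroup.closure_le]
    rintro _ ⟨a, rfl⟩
    exact pauliUnit_mem_pauliGroup _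
  · intro P hP Q hQ
    have : ∀ x ∈ Set.range (fun a => pauliUnit (f a)), ∀ y ∈ Set.range (fun a => pauliUnit (f a)),
        x * y = y * x := by
      rintro _ ⟨a, rfl⟩ _ ⟨b, rfl⟩
      exact Units.ext (pauli_commute (hf a b)).eq
    exact Subgroup.closure_induction₂ (p := fun x y _ _ => x * y = y * x)
      (fun x y hx hy => this x hx y hy)
      (fun x _ => by simp) (fun x _ => by simp)
      (fun x y z _ _ _ h1 h2 => by rw [mul_assoc, h2, ← mul_assoc, h1, mul_assoc])
      (fun x y z _ _ _ h1 h2 => by rw [← mul_assoc, h1, mul_assoc, h2, mul_assoc])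
      (fun x y _ _ h => ((show Commute x y from h).inv_left).eq)
      (fun x y _ _ h => ((show Commute x y from h).inv_right).eq) hP hQ
  · have hval : ∀ P ∈ G, (P : Op n q) *ᵥ U.col i =
        (star (U.col i) ⬝ᵥ ((P : Op n q) *ᵥ U.col i)) • U.col i := by
      intro P hP
      obtain ⟨c, hc⟩ := hGeig P hP
      rw [hc, dotProduct_smul, hunit, smul_eq_mul, mul_one]
    intro φ
    constructor
    · intro h
      -- The coordinates of `φ` in the joint eigenbasis, all but one of which vanish.
      set y := Uᴴ *ᵥ φ with hy
      have hφ : φ = U *ᵥ y := by rw [hy, Matrix.mulVec_mulVec, hU', Matrix.one_mulVec]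
      have h1 : ∀ a j, χ a j * y j = χ a i * y j := by
        intro a j
        have h2 := h _ (hgen a)
        beta_reduce at h2
        have h3 : star (U.col i) ⬝ᵥ (((pauliUnit (f a) : (Op n q)ˣ) : Op n q) *ᵥ U.col i) =
            χ a i := by
          change star (U.col i) ⬝ᵥ (pauli (f a) *ᵥ U.col i) = _
          rw [heig, dotProduct_smul, hunit, smul_eq_mul, mul_one]
        rw [h3] at h2
        change pauli (f a) *ᵥ φ = _ at h2
        rw [hφ, Matrix.mulVec_mulVec, hχ, ← Matrix.mulVec_smul] at h2
        have h4 := congrArg (fun v => Uᴴ *ᵥ v) h2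
        simp only [Matrix.mulVec_mulVec, ← mul_assoc, hU, one_mul, Matrix.one_mulVec] at h4
        have h5 := congrFun h4 j
        rwa [Matrix.mulVec_diagonal] at h5
      have h0 : ∀ j, j ≠ i → y j = 0 := by
        intro j hj
        have h2 : ((q : ℂ) ^ n) * y j = 0 := by
          have h3 := sum_star_mul_eigenvalues_col hinj hU hχ i i
          have h4 := sum_star_mul_eigenvalues_col hinj hU hχ i j
          rw [if_pos rfl] at h3
          rw [if_neg hj.symm] at h4
          rw [← h3, Finset.sum_mul]
          calc ∑ a, star (χ a i) * χ a i * y j = ∑ a, star (χ a i) * χ a j * y j :=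
                Finset.sum_congr rfl fun a _ => by rw [mul_assoc, ← h1, mul_assoc]
            _ = 0 := by rw [← Finset.sum_mul, h4, zero_mul]
        exact (mul_eq_zero.mp h2).resolve_left hd
      refine ⟨y i, ?_⟩
      rw [hφ]
      ext x
      rw [Matrix.mulVec, dotProduct, Finset.sum_eq_single i
        (fun j _ hj => by rw [h0 j hj, mul_zero]) (fun h => absurd (Finset.mem_univ i) h)]
      exact mul_comm _ _
    · rintro ⟨c, rfl⟩ P hP
      rw [Matrix.mulVec_smul, hval P hP, smul_comm]

end StabilizerBasis

/-! ### Divisibility by the primes dividing `q` in `ZMod q` -/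

section Divisibility

variable {q : ℕ} [NeZero q]

lemma natCast_dvd_natCast_zmod {p k : ℕ} (hp : p ∣ q) : (p : ZMod q) ∣ (k : ZMod q) ↔ p ∣ k := by
  constructor
  · rintro ⟨y, hy⟩
    rw [← ZMod.natCast_zmod_val y, ← Nat.cast_mul, ZMod.natCast_eq_natCast_iff] at hy
    exact (hy.dvd_iff hp).mpr (dvd_mul_right _ _)
  · rintro ⟨y, rfl⟩
    exact ⟨y, by push_cast; rfl⟩

lemma natCast_dvd_iff_dvd_val {p : ℕ} (hp : p ∣ q) (x : ZMod q) : (p : ZMod q) ∣ x ↔ p ∣ x.val := by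
  rw [← natCast_dvd_natCast_zmod hp, ZMod.natCast_zmod_val]

lemma natCast_dvd_or_dvd_of_dvd_mul {p : ℕ} (hp : p ∈ q.primeFactors) {x y : ZMod q}
    (h : (p : ZMod q) ∣ x * y) : (p : ZMod q) ∣ x ∨ (p : ZMod q) ∣ y := by
  have hpq := Nat.dvd_of_mem_primeFactors hp
  rw [← ZMod.natCast_zmod_val x, ← ZMod.natCast_zmod_val y, ← Nat.cast_mul,
    natCast_dvd_natCast_zmod hpq, (Nat.prime_of_mem_primeFactors hp).dvd_mul] at h
  rwa [natCast_dvd_iff_dvd_val hpq, natCast_dvd_iff_dvd_val hpq]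

lemma isUnit_of_forall_not_dvd {x : ZMod q} (h : ∀ p ∈ q.primeFactors, ¬(p : ZMod q) ∣ x) :
    IsUnit x := by
  rw [← ZMod.natCast_zmod_val x, ZMod.isUnit_iff_coprime]
  refine Nat.Coprime.symm (Nat.coprime_of_dvd fun p hp hpq hpx => ?_)
  exact h p (Nat.mem_primeFactors.mpr ⟨hp, hpq, NeZero.ne q⟩)
    ((natCast_dvd_iff_dvd_val hpq x).mpr hpx)

/-- The Chinese remainder theorem, in the form of scalars which are nonzero modulo one prime and
zero modulo the others. -/
lemma not_dvd_sum_prod_erase {p : ℕ} (hp : p ∈ q.primeFactors) {f : ℕ → ZMod q}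
    (hf : ¬(p : ZMod q) ∣ f p) :
    ¬(p : ZMod q) ∣
      ∑ r ∈ q.primeFactors, ((∏ s ∈ q.primeFactors.erase r, s : ℕ) : ZMod q) * f r := by
  have hpq := Nat.dvd_of_mem_primeFactors hp
  have hpp := Nat.prime_of_mem_primeFactors hp
  rw [← Finset.add_sum_erase _ _ hp]
  have h1 : (p : ZMod q) ∣ ∑ r ∈ q.primeFactors.erase p,
      ((∏ s ∈ q.primeFactors.erase r, s : ℕ) : ZMod q) * f r := by
    refine Finset.dvd_sum fun r hr => Dvd.dvd.mul_right ?_ _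
    rw [natCast_dvd_natCast_zmod hpq]
    exact Finset.dvd_prod_of_mem _ (Finset.mem_erase.mpr ⟨(Finset.ne_of_mem_erase hr).symm, hp⟩)
  rw [dvd_add_left h1]
  intro h
  rcases natCast_dvd_or_dvd_of_dvd_mul hp h with h | h
  · rw [natCast_dvd_natCast_zmod hpq, Prime.dvd_finsetProd_iff hpp.prime] at h
    obtain ⟨s, hs, hps⟩ := h
    have hs' := Finset.mem_erase.mp hs
    exact hs'.1 ((Nat.prime_dvd_prime_iff_eq hpp
      (Nat.prime_of_mem_primeFactors hs'.2)).mp hps).symm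
  · exact hf h

end Divisibility

/-! ### Counting primitive vectors -/

section Counting

variable {q : ℕ} [NeZero q]

/-- A vector over `ZMod q` is primitive if it is nonzero modulo every prime divisor of `q`. -/
def IsPrimitiveVec {κ : Type*} (w : κ → ZMod q) : Prop :=
  ∀ p ∈ q.primeFactors, ∃ i, ¬(p : ZMod q) ∣ w i

lemma card_filter_dvd_val {D : ℕ} (hD : D ∣ q) :
    (Finset.univ.filter fun x : ZMod q => D ∣ x.val).card = q / D := by
  have hD0 : 0 < D := Nat.pos_of_dvd_of_pos hD (NeZero.pos q)
  have hlt : ∀ k ∈ Finset.range (q / D), D * k < q := fun k hk => by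
    calc D * k < D * (q / D) := Nat.mul_lt_mul_of_pos_left (Finset.mem_range.mp hk) hD0
      _ = q := Nat.mul_div_cancel' hD
  rw [← Finset.card_range (q / D)]
  symm
  refine Finset.card_bij (fun k _ => ((D * k : ℕ) : ZMod q)) ?_ ?_ ?_
  · intro k hk
    rw [Finset.mem_filter, ZMod.val_natCast_of_lt (hlt k hk)]
    exact ⟨Finset.mem_univ _, dvd_mul_right _ _⟩
  · intro k hk k' hk' h
    have h2 := congrArg ZMod.val h
    rw [ZMod.val_natCast_of_lt (hlt k hk), ZMod.val_natCast_of_lt (hlt k' hk')] at h2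
    exact Nat.eq_of_mul_eq_mul_left hD0 h2
  · intro x hx
    obtain ⟨k, hk⟩ := (Finset.mem_filter.mp hx).2
    refine ⟨k, ?_, by rw [← hk, ZMod.natCast_zmod_val]⟩
    rw [Finset.mem_range, Nat.lt_div_iff_mul_lt' hD, ← hk]
    exact ZMod.val_lt x

open Classical in
/-- The number of primitive vectors of length `m`: Jordan's totient `q ^ m * ∏ p, (1 - p ^ (-m))`,
by inclusion and exclusion over the prime divisors of `q`. -/
lemma card_isPrimitiveVec (q : ℕ) [NeZero q] (κ : Type*) [Fintype κ] [DecidableEq κ] :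
    ((Finset.univ.filter fun w : κ → ZMod q => IsPrimitiveVec w).card : ℝ) =
      (q : ℝ) ^ Fintype.card κ * ∏ p ∈ q.primeFactors, (1 - ((p : ℝ) ^ Fintype.card κ)⁻¹) := by
  have hind : ∀ w : κ → ZMod q, (if IsPrimitiveVec w then (1 : ℝ) else 0) =
      ∏ p ∈ q.primeFactors, (1 - ∏ i, if p ∣ (w i).val then (1 : ℝ) else 0) := by
    intro w
    have hfac : ∀ p ∈ q.primeFactors, (1 - ∏ i, if p ∣ (w i).val then (1 : ℝ) else 0) =
        if ∃ i, ¬(p : ZMod q) ∣ w i then 1 else 0 := by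
      intro p hp
      have hpq := Nat.dvd_of_mem_primeFactors hp
      rw [Finset.prod_ite_zero]
      simp only [natCast_dvd_iff_dvd_val hpq, Finset.mem_univ, true_imp_iff, Finset.prod_const_one]
      by_cases h : ∀ i, p ∣ (w i).val
      · rw [if_pos h, if_neg (by push Not; exact h), sub_self]
      · rw [if_neg h, if_pos (by push Not at h; exact h), sub_zero]
    rw [Finset.prod_congr rfl hfac, Finset.prod_ite_zero]
    rw [Finset.prod_const_one]
    exact if_congr Iff.rfl rfl rfl
  have hsubset : ∀ S ∈ q.primeFactors.powerset,
      ∑ w : κ → ZMod q, ∏ p ∈ S, ∏ i, (if p ∣ (w i).val then (1 : ℝ) else 0) =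
        (q : ℝ) ^ Fintype.card κ * ∏ p ∈ S, ((p : ℝ) ^ Fintype.card κ)⁻¹ := by
    intro S hS
    rw [Finset.mem_powerset] at hS
    have hprime : ∀ p ∈ S, Prime p := fun p hp => (Nat.prime_of_mem_primeFactors (hS hp)).prime
    have hSq : ∏ p ∈ S, p ∣ q :=
      Finset.prod_primes_dvd q hprime fun p hp => Nat.dvd_of_mem_primeFactors (hS hp)
    have hone : ∀ x : ZMod q, ∏ p ∈ S, (if p ∣ x.val then (1 : ℝ) else 0) =
        if ∏ p ∈ S, p ∣ x.val then 1 else 0 := by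
      intro x
      rw [Finset.prod_ite_zero, Finset.prod_const_one]
      congr 1
      exact propext ⟨fun h => Finset.prod_primes_dvd _ hprime h,
        fun h p hp => (Finset.dvd_prod_of_mem _ hp).trans h⟩
    have hsum : ∑ x : ZMod q, ∏ p ∈ S, (if p ∣ x.val then (1 : ℝ) else 0) =
        (q : ℝ) * ∏ p ∈ S, (p : ℝ)⁻¹ := by
      simp only [hone]
      rw [Finset.sum_boole, card_filter_dvd_val hSq, Nat.cast_div hSq, Nat.cast_prod,
        Finset.prod_inv_distrib, div_eq_mul_inv]
      rw [Nat.cast_ne_zero, Finset.prod_ne_zero_iff]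
      exact fun p hp => (hprime p hp).ne_zero
    calc ∑ w : κ → ZMod q, ∏ p ∈ S, ∏ i, (if p ∣ (w i).val then (1 : ℝ) else 0)
        = ∑ w : κ → ZMod q, ∏ i, ∏ p ∈ S, (if p ∣ (w i).val then (1 : ℝ) else 0) :=
          Finset.sum_congr rfl fun w _ => Finset.prod_comm
      _ = ∏ _i : κ, ∑ x : ZMod q, ∏ p ∈ S, (if p ∣ x.val then (1 : ℝ) else 0) :=
          (Fintype.prod_sum (fun (_ : κ) (x : ZMod q) =>
            ∏ p ∈ S, (if p ∣ x.val then (1 : ℝ) else 0))).symm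
      _ = _ := by
          rw [hsum, Finset.prod_const, Finset.card_univ, mul_pow, ← Finset.prod_pow]
          simp only [inv_pow]
  rw [← Finset.sum_boole]
  simp only [hind, Finset.prod_sub, Finset.prod_const_one, mul_one]
  rw [Finset.sum_comm, Finset.mul_sum]
  refine Finset.sum_congr rfl fun S hS => ?_
  rw [← Finset.mul_sum, hsubset S hS]
  ring

end Counting

/-! ### The symplectic group and its action on primitive vectors -/

section Symplectic

variable {n q : ℕ}

/-- The symplectic group of the discrete phase space. -/
def symp (n q : ℕ) : Subgroup (Phase n q ≃ₗ[ZMod q] Phase n q) where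
  carrier := {g | ∀ v w, sympForm (g v) (g w) = sympForm v w}
  mul_mem' {g h} hg hh v w := (hg _ _).trans (hh v w)
  one_mem' _ _ := rfl
  inv_mem' {g} hg v w := by
    have h := hg (g⁻¹ v) (g⁻¹ w)
    rw [← LinearEquiv.mul_apply, ← LinearEquiv.mul_apply, mul_inv_cancel] at h
    exact h.symm

/-- The symplectic transvection along `h` with parameter `c`. -/
def transvection (h : Phase n q) (c : ZMod q) : Phase n q ≃ₗ[ZMod q] Phase n q where
  toFun v := v + (c * sympForm v h) • h
  invFun v := v - (c * sympForm v h) • h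
  map_add' v w := by
    rw [sympForm_add_left]
    module
  map_smul' a v := by
    rw [sympForm_smul_left, RingHom.id_apply]
    module
  left_inv v := by
    simp only [sympForm_add_left, sympForm_smul_left, sympForm_self]
    module
  right_inv v := by
    simp only [sub_eq_add_neg, ← neg_smul, sympForm_add_left, sympForm_smul_left, sympForm_self]
    module

lemma transvection_mem (h : Phase n q) (c : ZMod q) : transvection h c ∈ symp n q := by
  intro v w
  change sympForm (v + (c * sympForm v h) • h) (w + (c * sympForm w h) • h) = _
  rw [sympForm_add_left, sympForm_add_right, sympForm_add_right, sympForm_smul_left,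
    sympForm_smul_right, sympForm_smul_left, sympForm_smul_right, sympForm_self,
    ← sympForm_neg_swap w h]
  ring

/-- If `sympForm u w` is a unit, then a transvection along `w - u` maps `u` to `w`. -/
lemma exists_symp_apply_eq_of_isUnit {u w : Phase n q} (h : IsUnit (sympForm u w)) :
    ∃ g ∈ symp n q, g u = w := by
  obtain ⟨c, hc⟩ := h.exists_left_inv
  refine ⟨transvection (w - u) c, transvection_mem _ _, ?_⟩
  change u + (c * sympForm u (w - u)) • (w - u) = w
  rw [sub_eq_add_neg w u, sympForm_add_right, sympForm_neg_right, sympForm_self, neg_zero,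
    add_zero, hc, one_smul]
  abel

/-- A phase space point is primitive if it is nonzero modulo every prime divisor of `q`. -/
def IsPrimitivePhase (v : Phase n q) : Prop :=
  ∀ p ∈ q.primeFactors, ¬((∀ i, (p : ZMod q) ∣ v.1 i) ∧ ∀ i, (p : ZMod q) ∣ v.2 i)

lemma exists_not_dvd_sympForm {v : Phase n q} (hv : IsPrimitivePhase v) {p : ℕ}
    (hp : p ∈ q.primeFactors) : ∃ z, ¬(p : ZMod q) ∣ sympForm v z := by
  have h := hv p hp
  rw [not_and_or] at h
  push Not at h
  rcases h with ⟨i, hi⟩ | ⟨i, hi⟩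
  · exact ⟨(0, Pi.single i 1), by simpa [sympForm] using hi⟩
  · exact ⟨(Pi.single i 1, 0), by simpa [sympForm] using hi⟩

/-- Modulo a prime, the complement of two hyperplanes is not empty. -/
lemma exists_not_dvd_sympForm_pair {u w : Phase n q} (hu : IsPrimitivePhase u)
    (hw : IsPrimitivePhase w) {p : ℕ} (hp : p ∈ q.primeFactors) :
    ∃ z, ¬(p : ZMod q) ∣ sympForm u z ∧ ¬(p : ZMod q) ∣ sympForm w z := by
  obtain ⟨z₁, h₁⟩ := exists_not_dvd_sympForm hu hp
  obtain ⟨z₂, h₂⟩ := exists_not_dvd_sympForm hw hp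
  by_cases h₃ : (p : ZMod q) ∣ sympForm w z₁
  · by_cases h₄ : (p : ZMod q) ∣ sympForm u z₂
    · refine ⟨z₁ + z₂, ?_, ?_⟩
      · rwa [sympForm_add_right, dvd_add_left h₄]
      · rwa [sympForm_add_right, dvd_add_right h₃]
    · exact ⟨z₂, h₄, h₂⟩
  · exact ⟨z₁, h₁, h₃⟩

lemma IsPrimitivePhase.map {v : Phase n q} (hv : IsPrimitivePhase v)
    (g : Phase n q ≃ₗ[ZMod q] Phase n q) : IsPrimitivePhase (g v) := by
  intro p hp h
  apply hv p hp
  -- Divisibility of all coordinates by `p` means being `p` times a vector.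
  choose a ha using h.1
  choose b hb using h.2
  have h1 : g v = (p : ZMod q) • ((a, b) : Phase n q) :=
    Prod.ext (funext ha) (funext hb)
  have h2 : v = (p : ZMod q) • g.symm (a, b) := by
    rw [← map_smul, ← h1, LinearEquiv.symm_apply_apply]
  rw [h2]
  exact ⟨fun i => ⟨_, rfl⟩, fun i => ⟨_, rfl⟩⟩

lemma isPrimitivePhase_map_iff {v : Phase n q} (g : Phase n q ≃ₗ[ZMod q] Phase n q) :
    IsPrimitivePhase (g v) ↔ IsPrimitivePhase v :=
  ⟨fun h => by simpa using h.map g.symm, fun h => h.map g⟩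

variable [NeZero q]

lemma exists_isUnit_sympForm {u w : Phase n q} (hu : IsPrimitivePhase u)
    (hw : IsPrimitivePhase w) : ∃ z, IsUnit (sympForm u z) ∧ IsUnit (sympForm w z) := by
  have h : ∀ p : ℕ, ∃ z : Phase n q, p ∈ q.primeFactors →
      ¬(p : ZMod q) ∣ sympForm u z ∧ ¬(p : ZMod q) ∣ sympForm w z := by
    intro p
    by_cases hp : p ∈ q.primeFactors
    · obtain ⟨z, hz⟩ := exists_not_dvd_sympForm_pair hu hw hp
      exact ⟨z, fun _ => hz⟩
    · exact ⟨0, fun h => absurd h hp⟩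
  choose z hz using h
  have hlin : ∀ v : Phase n q, sympForm v (∑ r ∈ q.primeFactors,
      ((∏ s ∈ q.primeFactors.erase r, s : ℕ) : ZMod q) • z r) =
      ∑ r ∈ q.primeFactors, ((∏ s ∈ q.primeFactors.erase r, s : ℕ) : ZMod q) *
        sympForm v (z r) := by
    intro v
    have := map_sum (AddMonoidHom.mk' (fun w : Phase n q => sympForm v w) (sympForm_add_right v))
      (fun r => ((∏ s ∈ q.primeFactors.erase r, s : ℕ) : ZMod q) • z r) q.primeFactors
    simpa only [AddMonoidHom.mk'_apply, sympForm_smul_right] using this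
  refine ⟨∑ r ∈ q.primeFactors, ((∏ s ∈ q.primeFactors.erase r, s : ℕ) : ZMod q) • z r,
    isUnit_of_forall_not_dvd fun p hp => ?_, isUnit_of_forall_not_dvd fun p hp => ?_⟩
  · rw [hlin]
    exact not_dvd_sum_prod_erase hp (f := fun r => sympForm u (z r)) (hz p hp).1
  · rw [hlin]
    exact not_dvd_sum_prod_erase hp (f := fun r => sympForm w (z r)) (hz p hp).2

/-- The symplectic group acts transitively on primitive points. -/
lemma exists_symp_apply_eq {u w : Phase n q} (hu : IsPrimitivePhase u)
    (hw : IsPrimitivePhase w) : ∃ g ∈ symp n q, g u = w := by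
  obtain ⟨z, hz₁, hz₂⟩ := exists_isUnit_sympForm hu hw
  rw [← IsUnit.neg_iff, sympForm_neg_swap] at hz₂
  obtain ⟨g, hg, rfl⟩ := exists_symp_apply_eq_of_isUnit hz₁
  obtain ⟨h, hh, hw'⟩ := exists_symp_apply_eq_of_isUnit hz₂
  exact ⟨h * g, mul_mem hh hg, hw'⟩

/-- Every nonzero point is a multiple of a primitive point: divide by the greatest common divisor
of the coordinates. -/
lemma exists_isPrimitivePhase_smul_eq {v : Phase n q} (hv : v ≠ 0) :
    ∃ (c : ZMod q) (u : Phase n q), IsPrimitivePhase u ∧ v = c • u := by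
  have hne : (Finset.univ : Finset (Fin n ⊕ Fin n)).Nonempty := by
    by_contra h
    rw [Finset.not_nonempty_iff_eq_empty, Finset.univ_eq_empty_iff, isEmpty_sum] at h
    have := h.1
    exact hv (Subsingleton.elim _ _)
  obtain ⟨g, hg, hg1⟩ := Finset.extract_gcd (fun i : Fin n ⊕ Fin n => (Sum.elim v.1 v.2 i).val) hne
  set k := Finset.univ.gcd fun i : Fin n ⊕ Fin n => (Sum.elim v.1 v.2 i).val
  refine ⟨k, (fun i => (g (Sum.inl i) : ZMod q), fun i => (g (Sum.inr i) : ZMod q)), ?_, ?_⟩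
  · rintro p hp ⟨h1, h2⟩
    have hpq := Nat.dvd_of_mem_primeFactors hp
    have : p ∣ Finset.univ.gcd g := by
      refine Finset.dvd_gcd fun i _ => ?_
      rcases i with i | i
      · exact (natCast_dvd_natCast_zmod hpq).mp (h1 i)
      · exact (natCast_dvd_natCast_zmod hpq).mp (h2 i)
    rw [hg1] at this
    exact (Nat.prime_of_mem_primeFactors hp).one_lt.ne' (Nat.dvd_one.mp this)
  · refine Prod.ext (funext fun i => ?_) (funext fun i => ?_)
    · have := hg (Sum.inl i) (Finset.mem_univ _)
      rw [Sum.elim_inl] at this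
      change v.1 i = (k : ZMod q) * (g (Sum.inl i) : ZMod q)
      rw [← Nat.cast_mul, ← this, ZMod.natCast_zmod_val]
    · have := hg (Sum.inr i) (Finset.mem_univ _)
      rw [Sum.elim_inr] at this
      change v.2 i = (k : ZMod q) * (g (Sum.inr i) : ZMod q)
      rw [← Nat.cast_mul, ← this, ZMod.natCast_zmod_val]

instance : Finite (symp n q) :=
  Finite.of_injective (fun g : symp n q => (g.1 : Phase n q → Phase n q))
    fun _ _ h => Subtype.ext (DFunLike.coe_injective h)

noncomputable instance : Fintype (symp n q) := Fintype.ofFinite _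

open Classical in
/-- The number of `g` in the symplectic group for which the Lagrangian submodule
`g {(a, 0)}` contains `v`. -/
noncomputable def incidence (v : Phase n q) : ℕ :=
  (Finset.univ.filter fun g : symp n q => (g.1.symm v).2 = 0).card

lemma incidence_zero : incidence (0 : Phase n q) = Fintype.card (symp n q) := by
  simp [incidence]

lemma incidence_map (h : symp n q) (v : Phase n q) : incidence (h.1 v) = incidence v := by
  classical
  unfold incidence
  refine Finset.card_equiv (Equiv.mulLeft h⁻¹) fun g => ?_
  simp only [Finset.mem_filter, Finset.mem_univ, true_and]
  rfl

lemma incidence_le_incidence_smul (c : ZMod q) (v : Phase n q) :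
    incidence v ≤ incidence (c • v) := by
  classical
  refine Finset.card_le_card fun g hg => ?_
  rw [Finset.mem_filter] at hg ⊢
  refine ⟨hg.1, ?_⟩
  rw [map_smul, Prod.smul_snd, hg.2, smul_zero]

open Classical in
lemma sum_incidence_isPrimitivePhase :
    ∑ v : Phase n q with IsPrimitivePhase v, incidence v =
      Fintype.card (symp n q) *
        (Finset.univ.filter fun w : Fin n → ZMod q => IsPrimitiveVec w).card := by
  have h1 : ∀ v : Phase n q, incidence v = ∑ g : symp n q, if (g.1.symm v).2 = 0 then 1 else 0 :=
    fun v => by rw [incidence, Finset.card_filter]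
  simp only [h1]
  rw [Finset.sum_comm]
  have h2 : ∀ g : symp n q, ∑ v : Phase n q with IsPrimitivePhase v,
      (if (g.1.symm v).2 = 0 then 1 else 0) =
        (Finset.univ.filter fun w : Fin n → ZMod q => IsPrimitiveVec w).card := by
    intro g
    rw [← Finset.card_filter, Finset.filter_filter]
    refine Finset.card_bij (fun v _ => (g.1.symm v).1) ?_ ?_ ?_
    · intro v hv
      rw [Finset.mem_filter] at hv ⊢
      refine ⟨Finset.mem_univ _, fun p hp => ?_⟩
      have h3 := (isPrimitivePhase_map_iff g.1.symm).mpr hv.2.1 p hp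
      rw [hv.2.2, not_and_or] at h3
      push Not at h3
      rcases h3 with h3 | ⟨i, hi⟩
      · exact h3
      · exact absurd (dvd_zero _) hi
    · intro v hv w hw h
      rw [Finset.mem_filter] at hv hw
      exact g.1.symm.injective (Prod.ext h (hv.2.2.trans hw.2.2.symm))
    · intro a ha
      rw [Finset.mem_filter] at ha
      refine ⟨g.1 (a, 0), ?_, by rw [LinearEquiv.symm_apply_apply]⟩
      rw [Finset.mem_filter, LinearEquiv.symm_apply_apply, isPrimitivePhase_map_iff]
      refine ⟨Finset.mem_univ _, fun p hp h => ?_, rfl⟩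
      obtain ⟨i, hi⟩ := ha.2 p hp
      exact hi (h.1 i)
  rw [Finset.sum_congr rfl fun g _ => h2 g, Finset.sum_const, Finset.card_univ, smul_eq_mul]

open Classical in
lemma card_isPrimitivePhase :
    (Finset.univ.filter fun v : Phase n q => IsPrimitivePhase v).card =
      (Finset.univ.filter fun w : Fin n ⊕ Fin n → ZMod q => IsPrimitiveVec w).card := by
  refine Finset.card_equiv (Equiv.sumArrowEquivProdArrow _ _ _).symm fun v => ?_
  simp only [Finset.mem_filter, Finset.mem_univ, true_and]
  unfold IsPrimitivePhase IsPrimitiveVec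
  refine forall₂_congr fun p _ => ?_
  rw [not_and_or]
  push Not
  rw [Sum.exists]
  rfl

/-- A uniformly random symplectic image of `{(a, 0)}` contains any given point with probability at
least `1 / (q ^ n * ∏ p, (1 + p ^ (-n)))`. -/
lemma card_symp_le_incidence_mul {v : Phase n q} (hv : v ≠ 0) :
    (Fintype.card (symp n q) : ℝ) ≤
      incidence v * ((q : ℝ) ^ n * ∏ p ∈ q.primeFactors, (1 + ((p : ℝ) ^ n)⁻¹)) := by
  classical
  obtain ⟨c, u, hu, rfl⟩ := exists_isPrimitivePhase_smul_eq hv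
  have hn : n ≠ 0 := by
    rintro rfl
    exact hv (Subsingleton.elim _ _)
  have hq : (0 : ℝ) < q := Nat.cast_pos.mpr (NeZero.pos q)
  set J := ((Finset.univ.filter fun w : Fin n → ZMod q => IsPrimitiveVec w).card : ℝ) with hJ
  have hJ' : J = (q : ℝ) ^ n * ∏ p ∈ q.primeFactors, (1 - ((p : ℝ) ^ n)⁻¹) := by
    rw [hJ, card_isPrimitiveVec, Fintype.card_fin]
  have hJpos : 0 < J := by
    rw [hJ']
    refine mul_pos (pow_pos hq n) (Finset.prod_pos fun p hp => ?_)
    rw [sub_pos]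
    exact inv_lt_one_of_one_lt₀ (one_lt_pow₀
      (by exact_mod_cast (Nat.prime_of_mem_primeFactors hp).one_lt) hn)
  have hJ2 : ((Finset.univ.filter fun v : Phase n q => IsPrimitivePhase v).card : ℝ) =
      J * ((q : ℝ) ^ n * ∏ p ∈ q.primeFactors, (1 + ((p : ℝ) ^ n)⁻¹)) := by
    rw [card_isPrimitivePhase, card_isPrimitiveVec, Fintype.card_sum, Fintype.card_fin, hJ',
      mul_mul_mul_comm, ← Finset.prod_mul_distrib, ← pow_add]
    congr 1
    refine Finset.prod_congr rfl fun p _ => ?_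
    rw [pow_add, mul_inv]
    ring
  have hconst : ∀ v : Phase n q, IsPrimitivePhase v → incidence v = incidence u := by
    intro v hv
    obtain ⟨g, hg, rfl⟩ := exists_symp_apply_eq hu hv
    exact incidence_map ⟨g, hg⟩ u
  have hsum := sum_incidence_isPrimitivePhase (n := n) (q := q)
  rw [Finset.sum_congr rfl fun v hv => hconst v (Finset.mem_filter.mp hv).2, Finset.sum_const,
    smul_eq_mul] at hsum
  have hsum' : J * ((q : ℝ) ^ n * ∏ p ∈ q.primeFactors, (1 + ((p : ℝ) ^ n)⁻¹)) * incidence u =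
      Fintype.card (symp n q) * J := by
    rw [← hJ2, hJ]
    exact_mod_cast hsum
  have heq : (Fintype.card (symp n q) : ℝ) =
      incidence u * ((q : ℝ) ^ n * ∏ p ∈ q.primeFactors, (1 + ((p : ℝ) ^ n)⁻¹)) := by
    apply mul_right_cancel₀ hJpos.ne'
    rw [← hsum']
    ring
  rw [heq]
  refine mul_le_mul_of_nonneg_right (by exact_mod_cast incidence_le_incidence_smul c u) ?_
  exact mul_nonneg (pow_nonneg hq.le n) (Finset.prod_nonneg fun p _ => by positivity)

end Symplectic

/-! ### A numerical inequality -/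

section Numerical

lemma exp_two_div_le {p : ℕ} (hp : p.Prime) :
    Real.exp (2 / p) ≤ if p = 2 then 3 else 2 / 3 * (p : ℝ) := by
  have he : Real.exp 1 ≤ 2.7182818286 := Real.exp_one_lt_d9.le
  split_ifs with h2
  · subst h2
    norm_num
    linarith
  · have h3 : 3 ≤ p := lt_of_le_of_ne hp.two_le (Ne.symm h2)
    rcases h3.eq_or_lt with rfl | h4
    · have h8 : Real.exp (2 / 3) ^ 3 ≤ 2 ^ 3 := by
        rw [← Real.exp_nat_mul]
        have : ((3 : ℕ) : ℝ) * (2 / 3) = 1 + 1 := by norm_num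
        rw [this, Real.exp_add]
        nlinarith [Real.exp_pos 1]
      have := le_of_pow_le_pow_left₀ (by norm_num) (by norm_num) h8
      norm_num
      exact this
    · have h5 : 5 ≤ p := by
        by_contra h
        have : p = 4 := by omega
        subst this
        exact absurd hp (by norm_num)
      have h5' : (5 : ℝ) ≤ p := by exact_mod_cast h5
      have h1 : Real.exp (2 / p) ≤ Real.exp 1 :=
        Real.exp_le_exp.mpr ((div_le_one (by linarith)).mpr (by linarith))
      linarith

lemma prod_exp_two_div_le {q : ℕ} (hq : 3 ≤ q) :
    ∏ p ∈ q.primeFactors, Real.exp (2 / p) ≤ q := by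
  have hle : ∏ p ∈ q.primeFactors, (p : ℝ) ≤ q := by
    rw [← Nat.cast_prod]
    exact Nat.cast_le.mpr (Nat.le_of_dvd (by omega) (Nat.prod_primeFactors_dvd q))
  refine (Finset.prod_le_prod (fun p _ => (Real.exp_pos _).le)
    fun p hp => exp_two_div_le (Nat.prime_of_mem_primeFactors hp)).trans ?_
  by_cases h2 : 2 ∈ q.primeFactors
  · rw [← Finset.mul_prod_erase _ _ h2, if_pos rfl]
    have hodd : ∏ p ∈ q.primeFactors.erase 2, (if p = 2 then (3 : ℝ) else 2 / 3 * p) =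
        ∏ p ∈ q.primeFactors.erase 2, (2 / 3 * (p : ℝ)) :=
      Finset.prod_congr rfl fun p hp => if_neg (Finset.ne_of_mem_erase hp)
    rw [hodd]
    rcases (q.primeFactors.erase 2).eq_empty_or_nonempty with he | ⟨r, hr⟩
    · rw [he, Finset.prod_empty, mul_one]
      exact_mod_cast hq
    · -- One odd prime contributes a factor `2 / 3`, which turns `3` into `2`.
      rw [← Finset.mul_prod_erase _ _ h2, ← Finset.mul_prod_erase _ _ hr] at hle
      rw [← Finset.mul_prod_erase _ _ hr]
      have h4 : ∏ p ∈ (q.primeFactors.erase 2).erase r, (2 / 3 * (p : ℝ)) ≤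
          ∏ p ∈ (q.primeFactors.erase 2).erase r, (p : ℝ) :=
        Finset.prod_le_prod (fun p _ => by positivity) fun p _ => by
          have : (0 : ℝ) ≤ p := Nat.cast_nonneg p
          linarith
      have h5 := mul_le_mul_of_nonneg_left h4 (show (0 : ℝ) ≤ 2 * r by positivity)
      push_cast at hle
      calc _ = 2 * (r : ℝ) * ∏ p ∈ (q.primeFactors.erase 2).erase r, (2 / 3 * (p : ℝ)) := by ring
        _ ≤ 2 * (r : ℝ) * ∏ p ∈ (q.primeFactors.erase 2).erase r, (p : ℝ) := h5
        _ ≤ q := by rw [mul_assoc]; exact hle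
  · refine (Finset.prod_le_prod (fun p _ => by positivity) fun p hp => ?_).trans hle
    rw [if_neg (by rintro rfl; exact h2 hp)]
    have : (0 : ℝ) ≤ p := Nat.cast_nonneg p
    linarith

/-- For `q ≥ 3` and `n ≥ 1` the product is at most `q ^ (2 ^ (-n))`, because
`(1 + p ^ (-n)) ^ (2 ^ n) ≤ exp (2 / p)`. For `q = 2` that fails, but then the left hand side equals
`q ^ (2 * n)`. -/
lemma one_add_mul_prod_le (n q : ℕ) [NeZero q] :
    1 + ((q : ℝ) ^ n - 1) * ((q : ℝ) ^ n * ∏ p ∈ q.primeFactors, (1 + ((p : ℝ) ^ n)⁻¹)) ≤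
      Real.exp (((n : ℝ) + (2 : ℝ) ^ (-(n : ℤ) - 1)) * Real.log q) ^ 2 := by
  have hq1 : (1 : ℝ) ≤ q := by exact_mod_cast NeZero.one_le
  have hd1 : (1 : ℝ) ≤ (q : ℝ) ^ n := one_le_pow₀ hq1
  set E := Real.exp (Real.log q / 2 ^ n) with hE
  have hE1 : 1 ≤ E := Real.one_le_exp (div_nonneg (Real.log_nonneg hq1) (by positivity))
  have hEpow : E ^ (2 ^ n) = q := by
    rw [hE, ← Real.exp_nat_mul]
    push_cast
    rw [mul_div_cancel₀ _ (by positivity), Real.exp_log (by linarith)]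
  have hC : Real.exp (((n : ℝ) + (2 : ℝ) ^ (-(n : ℤ) - 1)) * Real.log q) ^ 2 =
      ((q : ℝ) ^ n) ^ 2 * E := by
    have hlog : (q : ℝ) ^ n = Real.exp (n * Real.log q) := by
      rw [Real.exp_nat_mul, Real.exp_log (by linarith)]
    rw [hlog, ← Real.exp_nat_mul, ← Real.exp_nat_mul, hE, ← Real.exp_add]
    congr 1
    rw [zpow_sub₀ (two_ne_zero), zpow_neg, zpow_natCast]
    push_cast
    field_simp
  rw [hC]
  set d := (q : ℝ) ^ n with hd
  by_cases hn : n = 0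
  · have : d = 1 := by rw [hd, hn, pow_zero]
    rw [this]
    linarith
  by_cases hq3 : 3 ≤ q
  · set X := ∏ p ∈ q.primeFactors, (1 + ((p : ℝ) ^ n)⁻¹) with hX
    have hX1 : 1 ≤ X := by
      calc (1 : ℝ) = ∏ _p ∈ q.primeFactors, (1 : ℝ) := Finset.prod_const_one.symm
        _ ≤ X := Finset.prod_le_prod (fun _ _ => zero_le_one) fun p _ =>
          le_add_of_nonneg_right (by positivity)
    have hXE : X ≤ E := by
      refine le_of_pow_le_pow_left₀ (n := 2 ^ n) (by positivity) (by linarith) ?_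
      rw [hEpow]
      refine le_trans ?_ (prod_exp_two_div_le hq3)
      rw [hX, ← Finset.prod_pow]
      refine Finset.prod_le_prod (fun p _ => by positivity) fun p hp => ?_
      have hp2 : (2 : ℝ) ≤ p := by exact_mod_cast (Nat.prime_of_mem_primeFactors hp).two_le
      calc (1 + ((p : ℝ) ^ n)⁻¹) ^ (2 ^ n) ≤ Real.exp (((p : ℝ) ^ n)⁻¹) ^ (2 ^ n) :=
            pow_le_pow_left₀ (by positivity) (by rw [add_comm]; exact Real.add_one_le_exp _) _
        _ = Real.exp ((2 / p) ^ n) := by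
            rw [← Real.exp_nat_mul, div_pow, div_eq_mul_inv]
            push_cast
            rfl
        _ ≤ Real.exp (2 / p) := by
            refine Real.exp_le_exp.mpr (pow_le_of_le_one (by positivity) ?_ hn)
            exact (div_le_one (by linarith)).mpr hp2
    nlinarith [mul_le_mul_of_nonneg_left hXE (show 0 ≤ d ^ 2 by positivity),
      mul_le_mul hd1 hX1 zero_le_one (by linarith)]
  · have hq0 := NeZero.pos q
    interval_cases q
    · have : d = 1 := by rw [hd]; simp
      rw [this]
      linarith
    · rw [Nat.Prime.primeFactors Nat.prime_two, Finset.prod_singleton, ← hd]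
      have : d * (1 + d⁻¹) = d + 1 := by
        rw [mul_add, mul_inv_cancel₀ (by positivity), mul_one]
      rw [this]
      nlinarith [mul_le_mul_of_nonneg_left hE1 (show 0 ≤ d ^ 2 by positivity)]

end Numerical

/-! ### Robustness from signed decompositions -/

section Robustness

variable {n q : ℕ} [NeZero q]

/-- A signed decomposition of a state into stabilizer states bounds its log-robustness by the
logarithm of the `ℓ¹` norm of the coefficients: group the positive and the negative ones. -/
lemma logRobustness_le_of_eq_sum {κ : Type*} [Fintype κ] {ρ : Op n q} (hρ : IsState ρ)
    {x : κ → ℝ} {σ : κ → Op n q} (hσ : ∀ k, σ k ∈ stabMixtures n q) (hx : ρ = ∑ k, x k • σ k)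
    {C : ℝ} (hC : ∑ k, |x k| ≤ C) : logRobustness ρ ≤ (Real.log C : ℝ) := by
  have hsum : ∑ k, x k = 1 := by
    have h := hρ.2
    rw [hx, Matrix.trace_sum] at h
    simp only [Matrix.trace_smul, (isState_of_mem_stabMixtures (hσ _)).2] at h
    have h2 : ((∑ k, x k : ℝ) : ℂ) = 1 := by
      rw [← h]
      push_cast
      exact Finset.sum_congr rfl fun k _ => by simp
    exact_mod_cast h2
  obtain ⟨k₀⟩ : Nonempty κ := by
    by_contra h
    rw [not_nonempty_iff] at h
    simp at hsum
  set s := ∑ k, (x k)⁻ with hs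
  have hs0 : 0 ≤ s := Finset.sum_nonneg fun k _ => negPart_nonneg _
  have hpos : ∑ k, (x k)⁺ = 1 + s := by
    rw [← hsum, hs, ← Finset.sum_add_distrib]
    refine Finset.sum_congr rfl fun k _ => ?_
    linarith [posPart_sub_negPart (x k)]
  have habs : ∑ k, |x k| = 1 + 2 * s := by
    have : ∀ k, |x k| = (x k)⁺ + (x k)⁻ := fun k => (posPart_add_negPart (x k)).symm
    simp only [this, Finset.sum_add_distrib, hpos, ← hs]
    ring
  have hmix : ∀ y : κ → ℝ, (∀ k, 0 ≤ y k) → 0 < ∑ k, y k →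
      ∃ τ ∈ stabMixtures n q, ∑ k, y k • σ k = (∑ k, y k) • τ := by
    intro y hy hy0
    refine ⟨∑ k, (y k / ∑ k, y k) • σ k, (convex_convexHull ℝ _).sum_mem
      (fun k _ => div_nonneg (hy k) hy0.le) ?_ (fun k _ => hσ k), ?_⟩
    · rw [← Finset.sum_div, div_self hy0.ne']
    · rw [Finset.smul_sum]
      exact Finset.sum_congr rfl fun k _ => by rw [smul_smul, mul_div_cancel₀ _ hy0.ne']
  have hrob : robustness ρ ≤ ENNReal.ofReal s := by
    refine iInf₂_le (f := fun (s : ℝ≥0) _ => (s : ℝ≥0∞)) (⟨s, hs0⟩ : ℝ≥0) ?_ |>.trans_eq ?_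
    · obtain ⟨σ', hσ', h'⟩ := hmix (fun k => (x k)⁺) (fun k => posPart_nonneg _)
        (by rw [hpos]; linarith)
      have hneg : ∃ τ ∈ stabMixtures n q, ∑ k, (x k)⁻ • σ k = s • τ := by
        rcases hs0.eq_or_lt with h0 | h0
        · refine ⟨σ k₀, hσ k₀, ?_⟩
          rw [← h0, zero_smul]
          refine Finset.sum_eq_zero fun k _ => ?_
          rw [(Finset.sum_eq_zero_iff_of_nonneg fun k _ => negPart_nonneg (x k)).mp h0.symm k
            (Finset.mem_univ k), zero_smul]
        · exact hmix _ (fun k => negPart_nonneg _) h0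
      obtain ⟨τ, hτ, h''⟩ := hneg
      refine ⟨σ', hσ', τ, hτ, ?_⟩
      change ρ = (1 + s) • σ' - s • τ
      rw [← hpos, ← h', ← h'', ← Finset.sum_sub_distrib, hx]
      exact Finset.sum_congr rfl fun k _ => by rw [← sub_smul, posPart_sub_negPart]
    · rw [ENNReal.ofReal, Real.toNNReal_of_nonneg hs0]
      rfl
  have hC1 : 1 + 2 * s ≤ C := habs ▸ hC
  rw [← ENNReal.log_ofReal_of_pos (by linarith : 0 < C)]
  refine ENNReal.log_monotone ?_
  calc 1 + 2 * robustness ρ ≤ 1 + 2 * ENNReal.ofReal s := by gcongr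
    _ = ENNReal.ofReal (1 + 2 * s) := by
        rw [ENNReal.ofReal_add zero_le_one (by positivity), ENNReal.ofReal_one,
          ENNReal.ofReal_mul zero_le_two, ENNReal.ofReal_ofNat]
    _ ≤ ENNReal.ofReal C := ENNReal.ofReal_le_ofReal hC1

/-- Summing over the points of all symplectic images of `{(a, 0)}` counts each point with its
incidence number. -/
lemma sum_symp_sum_eq_sum_incidence {E : Type*} [AddCommMonoid E] (F : Phase n q → E) :
    ∑ g : symp n q, ∑ a : Idx n q, F (g.1 (a, 0)) = ∑ v, incidence v • F v := by
  classical
  have h1 : ∀ g : symp n q, ∑ a : Idx n q, F (g.1 (a, 0)) =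
      ∑ v, if (g.1.symm v).2 = 0 then F v else 0 := by
    intro g
    rw [← Equiv.sum_comp g.1.toEquiv, Fintype.sum_prod_type]
    refine Finset.sum_congr rfl fun a _ => ?_
    have : ∀ b : Idx n q, (if (g.1.symm (g.1.toEquiv (a, b))).2 = 0 then F (g.1.toEquiv (a, b))
        else 0) = if b = 0 then F (g.1 (a, b)) else 0 := by
      intro b
      have : g.1.symm (g.1.toEquiv (a, b)) = (a, b) := g.1.symm_apply_apply _
      rw [this]
      rfl
    simp only [this, Finset.sum_ite_eq', Finset.mem_univ, if_true]
  simp only [h1]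
  rw [Finset.sum_comm]
  refine Finset.sum_congr rfl fun v _ => ?_
  rw [← Finset.sum_filter, Finset.sum_const, incidence]

/-- A linear combination of `q ^ n` distinct commuting Pauli operators is a combination of
projectors onto stabilizer states, whose coefficients have a controlled `ℓ²` norm. -/
lemma exists_stabilizer_decomposition {f : Idx n q → Phase n q} (hinj : Function.Injective f)
    (hf : ∀ a b, sympForm (f a) (f b) = 0) (c : Idx n q → ℂ) :
    ∃ (σ : Idx n q → Op n q) (z : Idx n q → ℂ), (∀ i, σ i ∈ stabMixtures n q) ∧
      ∑ a, c a • pauli (f a) = ∑ i, z i • σ i ∧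
      ∑ i, Complex.normSq (z i) = (q : ℝ) ^ n * ∑ a, Complex.normSq (c a) := by
  obtain ⟨U, hU, χ, hχ⟩ := exists_unitary_pauli_mul_eq hf
  have hU' : U * Uᴴ = 1 := mul_eq_one_comm.mp hU
  refine ⟨fun i => Matrix.vecMulVec (U.col i) (star (U.col i)), fun i => ∑ a, c a * χ a i,
    fun i => subset_convexHull ℝ _ ⟨U.col i, isPureStabilizer_col hinj hf hU hχ i, rfl⟩, ?_, ?_⟩
  · ext x y
    have hp : ∀ a, pauli (f a) x y = ∑ i, U x i * χ a i * star (U y i) := by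
      intro a
      have h : pauli (f a) = U * Matrix.diagonal (χ a) * Uᴴ := by rw [← hχ, mul_assoc, hU', mul_one]
      rw [h, Matrix.mul_apply]
      exact Finset.sum_congr rfl fun i _ => by rw [Matrix.mul_diagonal, Matrix.conjTranspose_apply]
    simp only [Matrix.sum_apply, Matrix.smul_apply, hp, smul_eq_mul, Finset.mul_sum,
      Matrix.vecMulVec_apply, Finset.sum_mul]
    rw [Finset.sum_comm]
    refine Finset.sum_congr rfl fun i _ => Finset.sum_congr rfl fun a _ => ?_
    simp only [Matrix.col_apply, Pi.star_apply]
    ring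
  · have h : ((∑ i, Complex.normSq (∑ a, c a * χ a i) : ℝ) : ℂ) =
        (((q : ℝ) ^ n * ∑ a, Complex.normSq (c a) : ℝ) : ℂ) := by
      push_cast
      have h1 : ∀ i, (Complex.normSq (∑ a, c a * χ a i) : ℂ) =
          ∑ a, ∑ b, star (c a) * c b * (star (χ a i) * χ b i) := by
        intro i
        rw [Complex.normSq_eq_conj_mul_self, ← Complex.star_def, star_sum, Finset.sum_mul_sum]
        refine Finset.sum_congr rfl fun a _ => Finset.sum_congr rfl fun b _ => ?_
        rw [star_mul']
        ring
      simp only [h1]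
      rw [Finset.sum_comm, Finset.mul_sum]
      refine Finset.sum_congr rfl fun a _ => ?_
      rw [Finset.sum_comm]
      simp only [← Finset.mul_sum, sum_star_mul_eigenvalues_row hinj hU hχ, mul_ite, mul_zero,
        Finset.sum_ite_eq, Finset.mem_univ, if_true]
      rw [Complex.normSq_eq_conj_mul_self, Complex.star_def]
      ring
    exact_mod_cast h

lemma incidence_ne_zero (v : Phase n q) : (incidence v : ℝ) ≠ 0 := by
  have hG : (0 : ℝ) < Fintype.card (symp n q) := by exact_mod_cast Fintype.card_pos
  rcases eq_or_ne v 0 with rfl | hv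
  · rw [incidence_zero]
    exact hG.ne'
  · intro h
    have := card_symp_le_incidence_mul hv
    rw [h, zero_mul] at this
    linarith

/-- Every state is a signed mixture of stabilizer states. The Pauli expansion of `ρ` is distributed
over the symplectic images of the Lagrangian submodule `{(a, 0)}`, the coefficient at `v` in equal
parts to the images which contain `v`, and each part is diagonal in a stabilizer basis. -/
lemma logRobustness_le {ρ : Op n q} (hρ : IsState ρ) :
    logRobustness ρ ≤ ((((n : ℝ) + (2 : ℝ) ^ (-(n : ℤ) - 1)) * Real.log (q : ℝ) : ℝ) : EReal) := by
  have hd : (0 : ℝ) < (q : ℝ) ^ n := pow_pos (Nat.cast_pos.mpr (NeZero.pos q)) n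
  have hd1 : (1 : ℝ) ≤ (q : ℝ) ^ n := one_le_pow₀ (by exact_mod_cast NeZero.one_le)
  set d := (q : ℝ) ^ n with hd_def
  have hdC : ((q : ℂ) ^ n) = (d : ℂ) := by rw [hd_def]; push_cast; rfl
  set K : Phase n q → ℂ := fun v => pauliCoeff ρ v / ((d * incidence v : ℝ) : ℂ) with hK
  have hinj : ∀ g : symp n q, Function.Injective fun a : Idx n q => g.1 (a, 0) :=
    fun g a b h => (Prod.ext_iff.mp (g.1.injective h)).1
  have hiso : ∀ (g : symp n q) (a b : Idx n q), sympForm (g.1 (a, 0)) (g.1 (b, 0)) = 0 := by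
    intro g a b
    rw [g.2]
    simp [sympForm]
  have hdec := fun g : symp n q =>
    exists_stabilizer_decomposition (hinj g) (hiso g) fun a => K (g.1 (a, 0))
  choose σ z hσ hz hnorm using hdec
  have hsum : ρ = ∑ k : symp n q × Idx n q, z k.1 k.2 • σ k.1 k.2 := by
    rw [Fintype.sum_prod_type]
    simp only [← hz]
    rw [sum_symp_sum_eq_sum_incidence fun v => K v • pauli v]
    have hterm : ∀ v, incidence v • K v • pauli v = ((d : ℂ)⁻¹) • pauliCoeff ρ v • pauli v := by
      intro v
      have h := incidence_ne_zero v
      have h' : (incidence v : ℂ) ≠ 0 := by exact_mod_cast h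
      rw [← Nat.cast_smul_eq_nsmul ℂ, smul_smul, smul_smul, hK]
      congr 1
      push_cast
      field_simp
    rw [Finset.sum_congr rfl fun v _ => hterm v, ← Finset.smul_sum, sum_pauliCoeff_smul_pauli,
      hdC, smul_smul, inv_mul_cancel₀ (by exact_mod_cast hd.ne'), one_smul]
  -- As `ρ` is Hermitian, the imaginary parts of the coefficients cancel.
  have hre : ρ = ∑ k : symp n q × Idx n q, (z k.1 k.2).re • σ k.1 k.2 := by
    have hadj : ρ = ∑ k : symp n q × Idx n q, star (z k.1 k.2) • σ k.1 k.2 := by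
      conv_lhs => rw [← hρ.1.1.eq, hsum, Matrix.conjTranspose_sum]
      refine Finset.sum_congr rfl fun k _ => ?_
      rw [Matrix.conjTranspose_smul, (isState_of_mem_stabMixtures (hσ k.1 k.2)).1.1.eq]
    have h2 : (2 : ℂ) • ρ = (2 : ℂ) • ∑ k : symp n q × Idx n q, (z k.1 k.2).re • σ k.1 k.2 := by
      rw [two_smul]
      refine (congrArg₂ (· + ·) hsum hadj).trans ?_
      rw [← Finset.sum_add_distrib, Finset.smul_sum]
      refine Finset.sum_congr rfl fun k _ => ?_
      rw [← add_smul, Complex.star_def, Complex.add_conj, Complex.ofReal_mul, mul_smul,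
        Complex.ofReal_ofNat, Complex.coe_smul]
    exact smul_right_injective _ (two_ne_zero' ℂ) h2
  set G := (Fintype.card (symp n q) : ℝ) with hG
  set X := ∏ p ∈ q.primeFactors, (1 + ((p : ℝ) ^ n)⁻¹) with hX
  have hX0 : 0 ≤ X := Finset.prod_nonneg fun p _ => by positivity
  have hl2 : ∑ k : symp n q × Idx n q, Complex.normSq (z k.1 k.2) =
      d⁻¹ * ∑ v, Complex.normSq (pauliCoeff ρ v) / incidence v := by
    rw [Fintype.sum_prod_type]
    simp only [hnorm]
    rw [← Finset.mul_sum, sum_symp_sum_eq_sum_incidence fun v => Complex.normSq (K v),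
      Finset.mul_sum, Finset.mul_sum]
    refine Finset.sum_congr rfl fun v _ => ?_
    have h := incidence_ne_zero v
    rw [nsmul_eq_mul, hK, Complex.normSq_div, Complex.normSq_ofReal, ← hd_def]
    field_simp
  have hfrac : ∑ v, G * (Complex.normSq (pauliCoeff ρ v) / incidence v) ≤
      1 + (d - 1) * (d * X) := by
    have hle : ∀ v : Phase n q, v ≠ 0 → G * (Complex.normSq (pauliCoeff ρ v) / incidence v) ≤
        Complex.normSq (pauliCoeff ρ v) * (d * X) := by
      intro v hv
      have hpos : (0 : ℝ) < incidence v :=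
        lt_of_le_of_ne (Nat.cast_nonneg _) (incidence_ne_zero v).symm
      rw [← mul_div_assoc, div_le_iff₀ hpos]
      have := mul_le_mul_of_nonneg_left (card_symp_le_incidence_mul hv)
        (Complex.normSq_nonneg (pauliCoeff ρ v))
      linarith
    rw [← Finset.add_sum_erase _ _ (Finset.mem_univ (0 : Phase n q))]
    have h0 : G * (Complex.normSq (pauliCoeff ρ 0) / incidence (0 : Phase n q)) = 1 := by
      rw [pauliCoeff_zero hρ, map_one, incidence_zero, ← hG, mul_one_div_cancel]
      rw [hG, ← incidence_zero]
      exact incidence_ne_zero _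
    rw [h0]
    refine add_le_add le_rfl ((Finset.sum_le_sum fun v hv =>
      hle v (Finset.ne_of_mem_erase hv)).trans ?_)
    rw [← Finset.sum_mul]
    refine mul_le_mul_of_nonneg_right ?_ (by positivity)
    have hpur := sum_normSq_pauliCoeff_le hρ
    rw [← Finset.add_sum_erase _ _ (Finset.mem_univ (0 : Phase n q)), pauliCoeff_zero hρ,
      map_one] at hpur
    linarith
  set C := Real.exp (((n : ℝ) + (2 : ℝ) ^ (-(n : ℤ) - 1)) * Real.log q) with hC
  have hl1 : ∑ k : symp n q × Idx n q, |(z k.1 k.2).re| ≤ C := by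
    refine le_of_pow_le_pow_left₀ two_ne_zero (Real.exp_pos _).le ?_
    calc (∑ k : symp n q × Idx n q, |(z k.1 k.2).re|) ^ 2
        ≤ (Finset.univ : Finset (symp n q × Idx n q)).card *
            ∑ k : symp n q × Idx n q, |(z k.1 k.2).re| ^ 2 := sq_sum_le_card_mul_sum_sq
      _ ≤ (G * d) * ∑ k : symp n q × Idx n q, Complex.normSq (z k.1 k.2) := by
          have hcard : ((Finset.univ : Finset (symp n q × Idx n q)).card : ℝ) = G * d := by
            rw [Finset.card_univ, Fintype.card_prod, Fintype.card_fun, ZMod.card, Fintype.card_fin]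
            push_cast
            rfl
          rw [hcard]
          refine mul_le_mul_of_nonneg_left (Finset.sum_le_sum fun k _ => ?_) (by positivity)
          rw [sq_abs, Complex.normSq_apply]
          nlinarith [mul_self_nonneg (z k.1 k.2).im]
      _ = ∑ v, G * (Complex.normSq (pauliCoeff ρ v) / incidence v) := by
          rw [hl2, ← Finset.mul_sum]
          field_simp
      _ ≤ 1 + (d - 1) * (d * X) := hfrac
      _ ≤ C ^ 2 := one_add_mul_prod_le n q
  have hmain := logRobustness_le_of_eq_sum hρ (κ := symp n q × Idx n q)
    (x := fun k => (z k.1 k.2).re) (σ := fun k => σ k.1 k.2) (fun k => hσ k.1 k.2) hre hl1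
  rwa [hC, Real.log_exp] at hmain

end Robustness

end QuditMagic

theorem mainTheorem9 (n q : ℕ) [NeZero q] (ρ : QuditMagic.Op n q) (hρ : QuditMagic.IsState ρ) :
    (QuditMagic.logStabFidelity ρ ≤ QuditMagic.relEntropyMagic ρ ∧
      QuditMagic.relEntropyMagic ρ ≤ QuditMagic.maxRelEntropyMagic ρ ∧
      QuditMagic.maxRelEntropyMagic ρ ≤ QuditMagic.logGenRobustness ρ ∧
      QuditMagic.logGenRobustness ρ ≤ QuditMagic.logRobustness ρ) ∧
    (∀ M ∈ ({QuditMagic.logStabFidelity ρ, QuditMagic.relEntropyMagic ρ,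
        QuditMagic.maxRelEntropyMagic ρ, QuditMagic.logGenRobustness ρ,
        QuditMagic.logRobustness ρ} : Set EReal),
      M ≤ ((((n : ℝ) + (2 : ℝ) ^ (-(n : ℤ) - 1)) * Real.log (q : ℝ) : ℝ) : EReal)) := by
  have h1 := QuditMagic.logStabFidelity_le_relEntropyMagic hρ
  have h2 := QuditMagic.relEntropyMagic_le_maxRelEntropyMagic hρ
  have h3 := QuditMagic.maxRelEntropyMagic_le_logGenRobustness ρ
  have h4 := QuditMagic.logGenRobustness_le_logRobustness ρ
  have h5 := QuditMagic.logRobustness_le hρ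
  refine ⟨⟨h1, h2, h3, h4⟩, ?_⟩
  rintro M (rfl | rfl | rfl | rfl | rfl)
  · exact h1.trans (h2.trans (h3.trans (h4.trans h5)))
  · exact h2.trans (h3.trans (h4.trans h5))
  · exact h3.trans (h4.trans h5)
  · exact h4.trans h5
  · exact h5
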